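/- **Theorem (Mayer–Vietoris for bigraded path homology).** Let $R$ be a commutative ring. *Conventions.* A directed graph has a set of vertices and a set of edges, an edge being an ordered pair of vertices (loops are allowed); a map of directed graphs is a function on vertices sending each edge $x\to y$ either to an edge or to a single vertex. Let $d(x,y)\in\{0,1,2,\dots,\infty\}$ be the least number of edges of a directed path from $x$ to $y$. The reachability chain complex $\mathrm{RC}_*(G)$ is free over $R$ in degree $k\ge 0$ on the tuples $(x_0,\dots,x_k)$ of vertices with $x_{i-1}\neq x_i$ and $d(x_{i-1},x_i)<\infty$ for $1\le i\le k$, with differential $\partial(x_0,\dots,x_k)=\sum_{i=0}^k(-1)^i(x_0,\dots,\widehat{x_i},\dots,x_k)$, where terms with equal consecutive entries are omitted. It is filtered by the subcomplexes $F_\ell\mathrm{RC}_*(G)$ spanned by the tuples of length $\sum_i d(x_{i-1},x_i)\le\ell$. If $E^r_{*,*}(G)$ denotes the spectral sequence of this filtered complex, bigraded path homology is $\mathrm{PH}_{k,\ell}(G)=E^2_{\ell,k-\ell}(G)$, that is, $$\mathrm{PH}_{k,\ell}(G)=\frac{\{x\in F_\ell\mathrm{RC}_k:\partial x\in F_{\ell-2}\}}{\{x\in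 F_{\ell-1}\mathrm{RC}_k:\partial x\in F_{\ell-2}\}+\partial\{y\in F_{\ell+1}\mathrm{RC}_{k+1}:\partial y\in F_{\ell}\}},$$ which is functorial in $G$. A *cofibration* $i\colon A\to X$ is the inclusion of an induced subgraph such that (1) there are no edges of $X$ from vertices outside $A$ to vertices of $A$, and (2) for every vertex $x$ of $X$ that admits a path from some vertex of $A$, there is a vertex $\pi(x)$ of $A$ with $d(a,x)=d(a,\pi(x))+d(\pi(x),x)$ for all vertices $a$ of $A$ (distances in $X$). *Statement.* Let $i\colon A\to X$ be a cofibration, let $f\colon A\to Y$ be any map of directed graphs, and let $g\colon X\to X\cup_A Y$ and $j\colon Y\to X\cup_A Y$ be the maps into their pushout in the category of directed graphs. Then there are $R$-linear maps $\delta\colon\mathrm{PH}_{k,\ell}(X\cup_A Y)\to\mathrm{PH}_{k-1,\ell-1}(A)$, for all $k,\ell$, such that the sequence $$\cdots\to\mathrm{PH}_{k,\ell}(A)\xrightarrow{(i_*,-f_*)}\mathrm{PH}_{k,\ell}(X)\oplus\mathrm{PH}_{k,\ell}(Y)\xrightarrow{g_*\oplus j_*}\mathrm{PH}_{k,\ell}(X\cup_A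 Y)\xrightarrow{\ \delta\ }\mathrm{PH}_{k-1,\ell-1}(A)\to\cdots$$ is exact, where $(g_*\oplus j_*)(u,v)=g_*u+j_*v$; it ends on the right with $\cdots\to\mathrm{PH}_{0,\ell}(X\cup_A Y)\to 0$. -/

import Mathlib

open CategoryTheory

universe u v w

/-- A directed graph: a set of vertices and a set of ordered pairs of vertices, the edges.
Loops are permitted, parallel edges are not. -/
structure DiGraph : Type (u + 1) where
  /-- The set of vertices. -/
  V : Type u
  /-- The edge relation. -/
  graph : Digraph V

namespace DiGraph

/-- There is an edge `x → y`. -/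
abbrev Adj (G : DiGraph.{u}) (x y : G.V) : Prop := G.graph.Adj x y

/-- A map of directed graphs: every edge is sent to an edge or collapsed to a vertex. -/
@[ext]
structure Hom (G H : DiGraph.{u}) : Type u where
  toFun : G.V → H.V
  map_adj : ∀ x y, G.Adj x y → toFun x = toFun y ∨ H.Adj (toFun x) (toFun y)

/-- The category of directed graphs. -/
instance : Category.{u} DiGraph.{u} where
  Hom := Hom
  id G := ⟨id, fun _ _ h => Or.inr h⟩
  comp f g := ⟨g.toFun ∘ f.toFun, fun x y h => by
    rcases f.map_adj x y h with h | h
    · exact Or.inl (congrArg g.toFun h)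
    · exact g.map_adj _ _ h⟩

/-- `G.HasPath n x y`: there is a directed path with exactly `n` edges from `x` to `y`;
its vertices need not be distinct. -/
inductive HasPath (G : DiGraph.{u}) : ℕ → G.V → G.V → Prop
  | nil (x : G.V) : HasPath G 0 x x
  | cons {n : ℕ} {x y z : G.V} (h : G.Adj x y) (p : HasPath G n y z) : HasPath G (n + 1) x z

/-- There is a directed path from `x` to `y`. -/
def Reach (G : DiGraph.{u}) (x y : G.V) : Prop := ∃ n, G.HasPath n x y

/-- The shortest path metric, with value `⊤` if there is no path. -/
noncomputable def dist (G : DiGraph.{u}) (x y : G.V) : ℕ∞ :=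
  ⨅ (n : ℕ) (_ : G.HasPath n x y), (n : ℕ∞)

/-- A cofibration `i : A ⟶ X`: the inclusion of an induced subgraph such that no edge enters `A`
from outside, and such that for each vertex `x` in the reach of `A` there is a vertex `p` of `A`
with `d(a, x) = d(a, p) + d(p, x)` for all `a` in `A`, the distances being taken in `X`. -/
structure IsCofibration {A X : DiGraph.{u}} (i : A ⟶ X) : Prop where
  injective : Function.Injective i.toFun
  adj_iff : ∀ a b, X.Adj (i.toFun a) (i.toFun b) ↔ A.Adj a b
  no_entry : ∀ x a, x ∉ Set.range i.toFun → ¬ X.Adj x (i.toFun a)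
  exists_proj : ∀ x, (∃ a, X.Reach (i.toFun a) x) →
    ∃ p, ∀ a, X.dist (i.toFun a) x = X.dist (i.toFun a) (i.toFun p) + X.dist (i.toFun p) x

lemma HasPath.trans {G : DiGraph.{u}} {m n : ℕ} {x y z : G.V} (p : G.HasPath m x y)
    (q : G.HasPath n y z) : G.HasPath (m + n) x z := by
  induction p with
  | nil x => simpa using q
  | cons h _ ih => rw [Nat.add_right_comm]; exact HasPath.cons h (ih q)

lemma Reach.refl {G : DiGraph.{u}} (x : G.V) : G.Reach x x := ⟨0, .nil x⟩

lemma Reach.trans {G : DiGraph.{u}} {x y z : G.V} (p : G.Reach x y) (q : G.Reach y z) :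
    G.Reach x z := by
  obtain ⟨m, p⟩ := p
  obtain ⟨n, q⟩ := q
  exact ⟨m + n, p.trans q⟩

lemma HasPath.map {G H : DiGraph.{u}} (f : G ⟶ H) {n : ℕ} {x y : G.V} (p : G.HasPath n x y) :
    ∃ m ≤ n, H.HasPath m (f.toFun x) (f.toFun y) := by
  induction p with
  | nil x => exact ⟨0, le_rfl, .nil _⟩
  | cons h _ ih =>
    obtain ⟨m, hm, q⟩ := ih
    rcases f.map_adj _ _ h with h | h
    · exact ⟨m, by omega, h ▸ q⟩
    · exact ⟨m + 1, by omega, .cons h q⟩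

lemma Reach.map {G H : DiGraph.{u}} (f : G ⟶ H) {x y : G.V} (p : G.Reach x y) :
    H.Reach (f.toFun x) (f.toFun y) := by
  obtain ⟨n, p⟩ := p
  obtain ⟨m, -, q⟩ := p.map f
  exact ⟨m, q⟩

lemma dist_map_le {G H : DiGraph.{u}} (f : G ⟶ H) (x y : G.V) :
    H.dist (f.toFun x) (f.toFun y) ≤ G.dist x y := by
  refine le_iInf₂ fun n p => ?_
  obtain ⟨m, hm, q⟩ := p.map f
  exact (iInf₂_le m q).trans (by exact_mod_cast hm)

lemma dist_self (G : DiGraph.{u}) (x : G.V) : G.dist x x = 0 :=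
  le_antisymm (iInf₂_le_of_le 0 (HasPath.nil x) (by simp)) bot_le

lemma dist_triangle (G : DiGraph.{u}) (x y z : G.V) : G.dist x z ≤ G.dist x y + G.dist y z := by
  by_cases hp : ∃ m, G.HasPath m x y
  · by_cases hq : ∃ n, G.HasPath n y z
    · obtain ⟨m, p, hm⟩ : ∃ m, G.HasPath m x y ∧ G.dist x y = m := by
        classical
        refine ⟨Nat.find hp, Nat.find_spec hp,
          le_antisymm (iInf₂_le (Nat.find hp) (Nat.find_spec hp)) ?_⟩
        exact le_iInf₂ fun n p => by exact_mod_cast Nat.find_min' hp p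
      obtain ⟨n, q, hn⟩ : ∃ n, G.HasPath n y z ∧ G.dist y z = n := by
        classical
        refine ⟨Nat.find hq, Nat.find_spec hq,
          le_antisymm (iInf₂_le (Nat.find hq) (Nat.find_spec hq)) ?_⟩
        exact le_iInf₂ fun n p => by exact_mod_cast Nat.find_min' hq p
      rw [hm, hn]
      exact (iInf₂_le (m + n) (p.trans q)).trans (by simp)
    · push Not at hq
      simp [dist, hq]
  · push Not at hp
    simp [dist, hp]

/-! ### Reachability chains -/

/-- Consecutive entries of the tuple are joined by a directed path. -/
def IsReach (G : DiGraph.{u}) {k : ℕ} (x : Fin (k + 1) → G.V) : Prop :=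
  ∀ i : Fin k, G.Reach (x i.castSucc) (x i.succ)

/-- The generators of the reachability chains in degree `k`: the tuples `(x₀, …, x_k)` of vertices
whose consecutive entries are distinct and joined by a directed path. -/
def IsGen (G : DiGraph.{u}) {k : ℕ} (x : Fin (k + 1) → G.V) : Prop :=
  ∀ i : Fin k, x i.castSucc ≠ x i.succ ∧ G.Reach (x i.castSucc) (x i.succ)

/-- The type of generators in degree `k`. -/
abbrev Gen (G : DiGraph.{u}) (k : ℕ) : Type u := {x : Fin (k + 1) → G.V // G.IsGen x}

/-- The length `d(x₀, x₁) + ⋯ + d(x_{k-1}, x_k)` of a tuple. -/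
noncomputable def length (G : DiGraph.{u}) {k : ℕ} (x : Fin (k + 1) → G.V) : ℕ∞ :=
  ∑ i : Fin k, G.dist (x i.castSucc) (x i.succ)

/-- The reachability chains in degree `k`: the free `R`-module on the generators. -/
abbrev RC (R : Type v) [CommRing R] (G : DiGraph.{u}) (k : ℕ) : Type (max u v) := G.Gen k →₀ R

section

variable (R : Type v) [CommRing R]

open Classical in
/-- The basis element of a tuple if it is a generator, and zero otherwise. -/
noncomputable def genOrZero (G : DiGraph.{u}) {k : ℕ} (x : Fin (k + 1) → G.V) : RC R G k :=
  if h : G.IsGen x then Finsupp.single ⟨x, h⟩ 1 else 0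

/-- The boundary `∂(x₀, …, x_k) = ∑ (-1)ⁱ (x₀, …, x̂ᵢ, …, x_k)`, where terms with repeated
consecutive entries are omitted. -/
noncomputable def boundary (G : DiGraph.{u}) (k : ℕ) : RC R G (k + 1) →ₗ[R] RC R G k :=
  Finsupp.linearCombination R fun x : G.Gen (k + 1) =>
    ∑ i : Fin (k + 2), (-1 : R) ^ (i : ℕ) • genOrZero R G (i.removeNth x.1)

/-- The map on chains induced by a map of graphs: a tuple `(x₀, …, x_k)` is sent to
`(f x₀, …, f x_k)`, or to zero if the latter has repeated consecutive entries. -/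
noncomputable def chainMap {G H : DiGraph.{u}} (f : G ⟶ H) (k : ℕ) : RC R G k →ₗ[R] RC R H k :=
  Finsupp.linearCombination R fun x : G.Gen k => genOrZero R H (f.toFun ∘ x.1)

/-- The length filtration: `F_p RC_k(G)` is spanned by the generators of length at most `p`. -/
noncomputable def lengthFiltration (G : DiGraph.{u}) (p : ℤ) (k : ℕ) : Submodule R (RC R G k) :=
  Submodule.span R
    {c | ∃ x : G.Gen k, (∃ m : ℕ, G.length x.1 = m ∧ (m : ℤ) ≤ p) ∧ c = Finsupp.single x 1}

lemma IsGen.isReach {G : DiGraph.{u}} {k : ℕ} {x : Fin (k + 1) → G.V} (h : G.IsGen x) :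
    G.IsReach x := fun i => (h i).2

lemma IsReach.reach_of_le {G : DiGraph.{u}} {k : ℕ} {x : Fin (k + 1) → G.V} (h : G.IsReach x)
    {a b : Fin (k + 1)} (hab : a ≤ b) : G.Reach (x a) (x b) := by
  induction b using Fin.induction with
  | zero =>
    obtain rfl : a = 0 := Fin.le_zero_iff.mp hab
    exact Reach.refl _
  | succ b ih =>
    rcases hab.eq_or_lt with rfl | hlt
    · exact Reach.refl _
    · exact (ih (Fin.le_castSucc_iff.mpr hlt)).trans (h b)

lemma IsReach.removeNth {G : DiGraph.{u}} {k : ℕ} {x : Fin (k + 2) → G.V} (h : G.IsReach x)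
    (i : Fin (k + 2)) : G.IsReach (k := k) (i.removeNth x) := fun _ =>
  h.reach_of_le (Fin.strictMono_succAbove i (Fin.castSucc_lt_succ)).le

lemma IsReach.map {G H : DiGraph.{u}} (f : G ⟶ H) {k : ℕ} {x : Fin (k + 1) → G.V}
    (h : G.IsReach x) : H.IsReach (f.toFun ∘ x) := fun b => (h b).map f

lemma length_removeNth_le (G : DiGraph.{u}) {k : ℕ} (x : Fin (k + 2) → G.V) (i : Fin (k + 2)) :
    G.length (k := k) (i.removeNth x) ≤ G.length (k := k + 1) x := by
  induction k with
  | zero => simp [length]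
  | succ k ih =>
    have key : ∀ (n : ℕ) (y : Fin (n + 2) → G.V),
        G.length (k := n + 1) y = G.dist (y 0) (y 1) + G.length (k := n) (Fin.tail y) := by
      intro n y
      simp only [length, Fin.sum_univ_succ (n := n)]
      rfl
    induction i using Fin.cases with
    | zero => rw [Fin.removeNth_zero, key (k + 1) x]; exact le_add_self (a := G.length (Fin.tail x))
    | succ j =>
      rw [key, key]
      induction j using Fin.cases with
      | zero =>
        have h1 : Fin.tail (Fin.removeNth (Fin.succ 0) x) = Fin.tail (n := k + 1) (Fin.tail x) := by
          funext b
          simp [Fin.tail, Fin.removeNth, Fin.succAbove, Fin.lt_def]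
        rw [key k (Fin.tail x), h1, ← add_assoc]
        gcongr
        exact G.dist_triangle _ _ _
      | succ j =>
        have h1 : Fin.tail (Fin.removeNth j.succ.succ x) =
            Fin.removeNth j.succ (Fin.tail (n := k + 2) x) := by
          funext b
          simp [Fin.tail, Fin.removeNth]
        rw [h1]
        refine add_le_add (le_of_eq ?_) (ih _ _)
        congr 1

lemma length_map_le {G H : DiGraph.{u}} (f : G ⟶ H) {k : ℕ} (x : Fin (k + 1) → G.V) :
    H.length (f.toFun ∘ x) ≤ G.length x :=
  Finset.sum_le_sum fun _ _ => dist_map_le f _ _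

lemma genOrZero_eq_zero {G : DiGraph.{u}} {k : ℕ} {x : Fin (k + 1) → G.V} {a : Fin k}
    (h : x a.castSucc = x a.succ) : genOrZero R G x = 0 :=
  dif_neg fun hx => (hx a).1 h

lemma genOrZero_of_isGen {G : DiGraph.{u}} {k : ℕ} {x : Fin (k + 1) → G.V}
    (h : G.IsGen x) : genOrZero R G x = Finsupp.single ⟨x, h⟩ 1 := dif_pos h

lemma genOrZero_val {G : DiGraph.{u}} {k : ℕ} (x : G.Gen k) :
    genOrZero R G x.1 = Finsupp.single x 1 := dif_pos x.2

lemma exists_eq_of_not_isGen {G : DiGraph.{u}} {k : ℕ} {x : Fin (k + 1) → G.V}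
    (hr : G.IsReach x) (h : ¬ G.IsGen x) : ∃ a : Fin k, x a.castSucc = x a.succ := by
  by_contra! hne
  exact h fun a => ⟨hne a, hr a⟩

lemma chainMap_genOrZero {G H : DiGraph.{u}} (f : G ⟶ H) {k : ℕ} {x : Fin (k + 1) → G.V}
    (hr : G.IsReach x) :
    chainMap R f k (genOrZero R G x) = genOrZero R H (f.toFun ∘ x) := by
  by_cases h : G.IsGen x
  · simp [genOrZero_of_isGen R h, chainMap]
  · obtain ⟨a, ha⟩ := exists_eq_of_not_isGen hr h
    rw [genOrZero_eq_zero R ha, map_zero, genOrZero_eq_zero R (a := a)]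
    simp [ha]

lemma boundary_genOrZero {G : DiGraph.{u}} {k : ℕ} {x : Fin (k + 2) → G.V}
    (hr : G.IsReach (k := k + 1) x) :
    boundary R G k (genOrZero R G (k := k + 1) x) =
      ∑ i : Fin (k + 2), (-1 : R) ^ (i : ℕ) • genOrZero R G (k := k) (i.removeNth x) := by
  by_cases h : G.IsGen (k := k + 1) x
  · simp [genOrZero_of_isGen R h, boundary]
  · obtain ⟨a, ha⟩ := exists_eq_of_not_isGen hr h
    rw [genOrZero_eq_zero R ha, map_zero]
    have hne : a.castSucc ≠ a.succ := (Fin.castSucc_lt_succ).ne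
    rw [Finset.sum_eq_add a.castSucc a.succ hne]
    · have hface : Fin.removeNth a.castSucc x = Fin.removeNth a.succ x := by
        funext b
        simp only [Fin.removeNth]
        rcases lt_trichotomy b a with hb | rfl | hb
        · rw [Fin.succAbove_of_castSucc_lt _ _ (by simpa using hb),
            Fin.succAbove_of_castSucc_lt _ _ (by simp only [Fin.lt_def, Fin.val_castSucc, Fin.val_succ] at hb ⊢; omega)]
        · simp [ha]
        · rw [Fin.succAbove_of_le_castSucc _ _ (by simpa using hb.le),
            Fin.succAbove_of_le_castSucc _ _ (by simp only [Fin.lt_def, Fin.le_def, Fin.val_castSucc, Fin.val_succ] at hb ⊢; omega)]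
      rw [hface, ← add_smul]
      simp [pow_succ]
    · rintro i - ⟨h1, h2⟩
      have : ∃ b : Fin k, i.succAbove b.castSucc = a.castSucc ∧ i.succAbove b.succ = a.succ := by
        have h1' : (i : ℕ) ≠ a := fun h => h1 (Fin.ext h)
        have h2' : (i : ℕ) ≠ a + 1 := fun h => h2 (Fin.ext h)
        rcases lt_or_gt_of_ne h1' with hi | hi
        · refine ⟨⟨a - 1, by omega⟩, ?_, ?_⟩ <;>
            · simp only [Fin.succAbove, Fin.lt_def, Fin.ext_iff, apply_ite Fin.val, Fin.val_castSucc,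
                Fin.val_succ]
              split_ifs <;> omega
        · refine ⟨⟨a, by omega⟩, ?_, ?_⟩ <;>
            · simp only [Fin.succAbove, Fin.lt_def, Fin.ext_iff, apply_ite Fin.val, Fin.val_castSucc,
                Fin.val_succ]
              split_ifs <;> omega
      obtain ⟨b, hb1, hb2⟩ := this
      rw [genOrZero_eq_zero R (a := b), smul_zero]
      simp only [Fin.removeNth, hb1, hb2, ha]
    · simp
    · simp

lemma boundary_boundary (G : DiGraph.{u}) (k : ℕ) :
    boundary R G k ∘ₗ boundary R G (k + 1) = 0 := by
  ext x : 2
  simp only [LinearMap.comp_apply, Finsupp.lsingle_apply, LinearMap.zero_apply]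
  rw [← genOrZero_val, boundary_genOrZero R x.2.isReach, map_sum]
  simp only [map_smul, boundary_genOrZero R (x.2.isReach.removeNth _), Finset.smul_sum, smul_smul]
  rw [← Finset.sum_product']
  refine Finset.sum_involution
    (fun p _ => (p.1.succAbove p.2, p.2.predAbove p.1)) ?_ ?_ ?_ ?_
  · rintro ⟨i, j⟩ -
    dsimp only
    rw [Fin.removeNth_removeNth_eq_swap, ← add_smul, ← pow_add, ← pow_add,
      Fin.neg_one_pow_succAbove_add_predAbove]
    simp
  · rintro ⟨i, j⟩ - - h
    exact Fin.succAbove_ne i j (congrArg Prod.fst h)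
  · simp
  · rintro ⟨i, j⟩ -
    simp [Fin.succAbove_succAbove_predAbove, Fin.predAbove_predAbove_succAbove]

lemma boundary_chainMap {G H : DiGraph.{u}} (f : G ⟶ H) (k : ℕ) :
    boundary R H k ∘ₗ chainMap R f (k + 1) = chainMap R f k ∘ₗ boundary R G k := by
  ext x : 2
  simp only [LinearMap.comp_apply, Finsupp.lsingle_apply]
  rw [← genOrZero_val, boundary_genOrZero R x.2.isReach, chainMap_genOrZero R f x.2.isReach,
    boundary_genOrZero R (x.2.isReach.map f), map_sum]
  simp only [map_smul, chainMap_genOrZero R f (x.2.isReach.removeNth _)]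
  rfl

lemma genOrZero_mem_lengthFiltration {G : DiGraph.{u}} {p : ℤ} {k : ℕ} {x : Fin (k + 1) → G.V}
    {l : ℕ} (hl : G.length x ≤ l) (hp : (l : ℤ) ≤ p) :
    genOrZero R G x ∈ lengthFiltration R G p k := by
  by_cases h : G.IsGen x
  · rw [genOrZero_of_isGen R h]
    obtain ⟨m, hm⟩ := ENat.ne_top_iff_exists.mp (ne_top_of_le_ne_top (ENat.natCast_ne_top l) hl)
    refine Submodule.subset_span ⟨⟨x, h⟩, ⟨m, hm.symm, ?_⟩, rfl⟩
    rw [← hm] at hl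
    have : m ≤ l := by exact_mod_cast hl
    omega
  · rw [genOrZero, dif_neg h]
    exact zero_mem _

lemma lengthFiltration_mono (G : DiGraph.{u}) (k : ℕ) :
    Monotone fun p => lengthFiltration R G p k := fun _ _ h =>
  Submodule.span_mono fun _ ⟨x, ⟨m, hm, hp⟩, hc⟩ => ⟨x, ⟨m, hm, hp.trans h⟩, hc⟩

lemma boundary_mem (G : DiGraph.{u}) (p : ℤ) (k : ℕ) :
    lengthFiltration R G p (k + 1) ≤ (lengthFiltration R G p k).comap (boundary R G k) := by
  refine Submodule.span_le.mpr ?_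
  rintro _ ⟨x, ⟨m, hm, hp⟩, rfl⟩
  rw [SetLike.mem_coe, Submodule.mem_comap, ← genOrZero_val, boundary_genOrZero R x.2.isReach]
  exact Submodule.sum_mem _ fun i _ => Submodule.smul_mem _ _
    (genOrZero_mem_lengthFiltration R ((G.length_removeNth_le x.1 i).trans hm.le) hp)

lemma chainMap_mem {G H : DiGraph.{u}} (f : G ⟶ H) (p : ℤ) (k : ℕ) :
    lengthFiltration R G p k ≤ (lengthFiltration R H p k).comap (chainMap R f k) := by
  refine Submodule.span_le.mpr ?_
  rintro _ ⟨x, ⟨m, hm, hp⟩, rfl⟩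
  rw [SetLike.mem_coe, Submodule.mem_comap, ← genOrZero_val, chainMap_genOrZero R f x.2.isReach]
  exact genOrZero_mem_lengthFiltration R ((length_map_le f x.1).trans hm.le) hp

end

end DiGraph

/-! ### The spectral sequence of a filtered chain complex -/

/-- A chain complex of `R`-modules with an increasing filtration by subcomplexes. -/
structure FilteredComplex (R : Type v) [CommRing R] where
  /-- The underlying chain complex. -/
  C : ChainComplex (ModuleCat.{w} R) ℕ
  /-- `F p n` is the `p`-th step of the filtration in degree `n`. -/
  F : ℤ → ∀ n, Submodule R (C.X n)
  mono : ∀ n, Monotone fun p => F p n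
  d_mem : ∀ p m n, F p m ≤ (F p n).comap (C.d m n).hom

namespace FilteredComplex

variable {R : Type v} [CommRing R]

/-- A map of filtered chain complexes. -/
structure Hom (K L : FilteredComplex.{v, w} R) where
  /-- The underlying chain map. -/
  f : K.C ⟶ L.C
  map_mem : ∀ p n, K.F p n ≤ (L.F p n).comap (f.f n).hom

/-- The elements `x` of `F_p C_n` with `d x ∈ F_{p-r}`
(only `m = n - 1` matters, all other components of the differential being zero). -/
def Z (K : FilteredComplex.{v, w} R) (r p : ℤ) (n : ℕ) : Submodule R (K.C.X n) :=
  K.F p n ⊓ ⨅ m, (K.F (p - r) m).comap (K.C.d n m).hom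

/-- The submodule `Z^{r-1}_{p-1} + d Z^{r-1}_{p+r-1}` of `C_n` (contained in `Z^r_p`), by which
`Z^r_p` is divided to obtain the page `E^r`. -/
def B (K : FilteredComplex.{v, w} R) (r p : ℤ) (n : ℕ) : Submodule R (K.C.X n) :=
  K.Z (r - 1) (p - 1) n ⊔ (K.Z (r - 1) (p + r - 1) (n + 1)).map (K.C.d (n + 1) n).hom

lemma B_le_Z (K : FilteredComplex.{v, w} R) (r p : ℤ) (n : ℕ) : K.B r p n ≤ K.Z r p n := by
  refine sup_le (le_inf (inf_le_left.trans (K.mono n (by simp))) ?_) ?_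
  · refine inf_le_right.trans (le_of_eq ?_)
    simp [show p - 1 - (r - 1) = p - r by ring]
  · rintro _ ⟨y, ⟨-, hy⟩, rfl⟩
    refine ⟨?_, ?_⟩
    · have := (Submodule.mem_iInf _).mp hy n
      simpa [show p + r - 1 - (r - 1) = p by ring] using this
    · refine (Submodule.mem_iInf _).mpr fun m => ?_
      have : (K.C.d n m).hom ((K.C.d (n + 1) n).hom y) = 0 := by
        rw [← LinearMap.comp_apply, ← ModuleCat.hom_comp, K.C.d_comp_d]
        rfl
      simp [this]

/-- The page `E^r` of the spectral sequence in filtration degree `p` and total degree `n`,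
that is, `E^r_{p, n - p} = Z^r_p / (Z^{r-1}_{p-1} + d Z^{r-1}_{p+r-1})`. -/
abbrev Page (K : FilteredComplex.{v, w} R) (r : ℕ) (p : ℤ) (n : ℕ) : Type w :=
  K.Z r p n ⧸ (K.B r p n).submoduleOf (K.Z r p n)

lemma Hom.map_Z {K L : FilteredComplex.{v, w} R} (φ : Hom K L) (r p : ℤ) (n : ℕ) :
    K.Z r p n ≤ (L.Z r p n).comap (φ.f.f n).hom := by
  rintro x ⟨hx, hdx⟩
  refine ⟨φ.map_mem _ _ hx, (Submodule.mem_iInf _).mpr fun m => ?_⟩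
  have h := φ.map_mem _ _ ((Submodule.mem_iInf _).mp hdx m)
  rw [Submodule.mem_comap] at h ⊢
  rwa [← LinearMap.comp_apply, ← ModuleCat.hom_comp, φ.f.comm, ModuleCat.hom_comp,
    LinearMap.comp_apply]

lemma Hom.map_B {K L : FilteredComplex.{v, w} R} (φ : Hom K L) (r p : ℤ) (n : ℕ) :
    K.B r p n ≤ (L.B r p n).comap (φ.f.f n).hom := by
  refine sup_le ((φ.map_Z _ _ _).trans (Submodule.comap_mono le_sup_left)) ?_
  rintro _ ⟨y, hy, rfl⟩
  refine Submodule.mem_sup_right ⟨_, φ.map_Z _ _ _ hy, ?_⟩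
  rw [← LinearMap.comp_apply, ← ModuleCat.hom_comp, φ.f.comm, ModuleCat.hom_comp,
    LinearMap.comp_apply]

/-- The map on pages induced by a map of filtered chain complexes. -/
def Hom.page {K L : FilteredComplex.{v, w} R} (φ : Hom K L) (r : ℕ) (p : ℤ) (n : ℕ) :
    K.Page r p n →ₗ[R] L.Page r p n :=
  Submodule.mapQ _ _ ((φ.f.f n).hom.restrict (φ.map_Z r p n)) fun _ hx => φ.map_B r p n hx

end FilteredComplex

/-! ### Bigraded path homology -/

namespace DiGraph

variable (R : Type v) [CommRing R]

/-- The reachability chain complex of `G`. -/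
noncomputable abbrev reachComplex (G : DiGraph.{u}) : ChainComplex (ModuleCat.{max u v} R) ℕ :=
  ChainComplex.of (fun k => ModuleCat.of R (RC R G k)) (fun k => ModuleCat.ofHom (boundary R G k))
    fun k => by
      rw [← ModuleCat.ofHom_comp, boundary_boundary]
      rfl

lemma reachComplex_d (G : DiGraph.{u}) (k : ℕ) :
    (reachComplex R G).d (k + 1) k = ModuleCat.ofHom (boundary R G k) := ChainComplex.of_d
    (fun k => ModuleCat.of R (RC R G k)) (fun k => ModuleCat.ofHom (boundary R G k)) k

lemma reachComplex_d_of_ne (G : DiGraph.{u}) {m n : ℕ} (h : m ≠ n + 1) :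
    (reachComplex R G).d m n = 0 := ChainComplex.of_d_ne
    (fun k => ModuleCat.of R (RC R G k)) (fun k => ModuleCat.ofHom (boundary R G k)) h

/-- The reachability chain complex of `G` with the length filtration; its spectral sequence is the
magnitude-path spectral sequence of `G`. -/
noncomputable def filteredReach (G : DiGraph.{u}) : FilteredComplex.{v, max u v} R where
  C := reachComplex R G
  F p k := lengthFiltration R G p k
  mono k := lengthFiltration_mono R G k
  d_mem p m n := by
    by_cases h : m = n + 1
    · subst h
      intro x hx
      have := boundary_mem R G p n hx
      rw [Submodule.mem_comap, reachComplex_d]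
      exact this
    · intro x _
      rw [Submodule.mem_comap, reachComplex_d_of_ne R G h]
      exact zero_mem (lengthFiltration R G p n)

/-- The map of filtered reachability chain complexes induced by a map of directed graphs. -/
noncomputable def filteredReachMap {G H : DiGraph.{u}} (f : G ⟶ H) :
    FilteredComplex.Hom (filteredReach R G) (filteredReach R H) where
  f :=
    { f := fun k => ModuleCat.ofHom (chainMap R f k)
      comm' := by
        rintro _ n rfl
        refine Eq.trans ?_ (Eq.trans (congrArg ModuleCat.ofHom (boundary_chainMap R f n)) ?_)
        · rw [ModuleCat.ofHom_comp, ← reachComplex_d]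
          rfl
        · rw [ModuleCat.ofHom_comp, ← reachComplex_d]
          rfl }
  map_mem p k := chainMap_mem R f p k

/-- Bigraded path homology `PH_{k,ℓ}(G) = E²_{ℓ, k-ℓ}(G)`, for `k : ℕ` and `ℓ : ℤ`.
(It is zero for `k < 0`, since there are no reachability chains in negative degrees.) -/
abbrev PH (G : DiGraph.{u}) (k : ℕ) (l : ℤ) : Type (max u v) := (filteredReach R G).Page 2 l k

/-- The map on bigraded path homology induced by a map of directed graphs. -/
noncomputable def PH.map {G H : DiGraph.{u}} (f : G ⟶ H) (k : ℕ) (l : ℤ) :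
    PH R G k l →ₗ[R] PH R H k l := (filteredReachMap R f).page 2 l k

end DiGraph

/-! Path homology is the homology of the first page `E¹` under its differential. The sequence is
therefore the long exact homology sequence of a short exact sequence of complexes `0 → E¹(A) → E¹(X)
⊕ E¹(Y) → E¹(P) → 0`, with `P` the pushout; the connecting map lowers both indices by one because
the differential of `E¹` does. The short exact sequence is recorded in `IsPageOneBicartesian` on
representatives, as congruences between chains in `Z 1` modulo `B 1`, and the snake argument runs on
these.

It remains to understand `E¹`, the homology of chains graded by length. A face has the length of its
tuple only if it omits an interior vertex lying on a shortest path between its neighbours. No edge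
enters `A`, so the entries of a tuple in `A` form an initial segment, and a tuple lies in `A` once
its last entry does. Faces of full length keep the last entry; hence the graded chains of `X` split
into those of `A` and those ending outside `A`, and likewise for `P` and `Y`. Exactness becomes
excision: `g` is an isomorphism on the homology of the two complements.

For excision, call a tuple of the complement direct if at most its first entry lies in the subgraph,
that entry being then the projection of the second; all others are detours. Detours are closed under
faces of full length (`detourAt_removeNth`) and acyclic (`exists_boundary_of_detour`): if the last
entry in the subgraph is not the projection of its successor, the tuple is a face of the one with
that projection inserted, and this pairs off the detours. Direct tuples of `X` and `P` correspond
under `g` with their lengths: a path of the pushout from `Y` to a vertex `x` outside runs in `Y` to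
some `f a` and continues in `X` from `a`, so the image of the projection of `x` is again a
projection and the relevant distances do not change (`IsGluing.isExcisive`). -/

namespace FilteredComplex

variable {R : Type v} [CommRing R]

/-! ### The second page as the homology of the first -/

section pages

variable (K : FilteredComplex.{v, w} R)

lemma mem_Z {r p : ℤ} {n : ℕ} {x : K.C.X n} :
    x ∈ K.Z r p n ↔ x ∈ K.F p n ∧ ∀ m, (K.C.d n m).hom x ∈ K.F (p - r) m := by
  simp [Z]

lemma mem_Z_zero {p : ℤ} {n : ℕ} {x : K.C.X n} : x ∈ K.Z 0 p n ↔ x ∈ K.F p n := by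
  rw [mem_Z]
  exact ⟨fun h => h.1, fun h => ⟨h, fun m => by rw [sub_zero]; exact K.d_mem p n m h⟩⟩

/-- The form in which vanishing on the first page is used: quotients `E¹` are never handled, only
congruences modulo `F_{p-1} + d F_p`. -/
lemma mem_B_one {p : ℤ} {n : ℕ} {x : K.C.X n} :
    x ∈ K.B 1 p n ↔ ∃ e ∈ K.F (p - 1) n, ∃ w ∈ K.F p (n + 1),
      e + (K.C.d (n + 1) n).hom w = x := by
  have h1 : p + 1 - 1 = p := by ring
  simp [B, Submodule.mem_sup, mem_Z_zero, h1]

lemma mem_B_two {p : ℤ} {n : ℕ} {x : K.C.X n} :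
    x ∈ K.B 2 p n ↔ ∃ e ∈ K.Z 1 (p - 1) n, ∃ w ∈ K.Z 1 (p + 1) (n + 1),
      e + (K.C.d (n + 1) n).hom w = x := by
  have h1 : p + 2 - 1 = p + 1 := by ring
  have h2 : (2 : ℤ) - 1 = 1 := by norm_num
  simp [B, Submodule.mem_sup, h1, h2]

lemma d_d (n m k : ℕ) (x : K.C.X n) : (K.C.d m k).hom ((K.C.d n m).hom x) = 0 := by
  rw [← LinearMap.comp_apply, ← ModuleCat.hom_comp, K.C.d_comp_d]
  rfl

lemma F_le_B_one {p : ℤ} {n : ℕ} {x : K.C.X n} (hx : x ∈ K.F (p - 1) n) : x ∈ K.B 1 p n :=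
  (mem_B_one K).mpr ⟨x, hx, 0, zero_mem _, by simp⟩

lemma Z_two_le_Z_one {p : ℤ} {n : ℕ} {x : K.C.X n} (hx : x ∈ K.Z 2 p n) : x ∈ K.Z 1 p n := by
  rw [mem_Z] at hx ⊢
  exact ⟨hx.1, fun m => K.mono m (by omega) (hx.2 m)⟩

lemma d_mem_Z_one {p : ℤ} {n : ℕ} {x : K.C.X n} (hx : x ∈ K.Z 1 (p + 1) n) (m : ℕ) :
    (K.C.d n m).hom x ∈ K.Z 1 p m := by
  rw [mem_Z] at hx ⊢
  refine ⟨by simpa using hx.2 m, fun k => ?_⟩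
  rw [d_d]
  exact zero_mem _

lemma d_mem_B_one_of_F {p : ℤ} {n : ℕ} {x : K.C.X n} (hx : x ∈ K.F p n) (m : ℕ) :
    (K.C.d n m).hom x ∈ K.B 1 p m := by
  by_cases h : n = m + 1
  · subst h
    exact (mem_B_one K).mpr ⟨0, zero_mem _, x, hx, by simp⟩
  · rw [K.C.shape n m (fun h' => h h'.symm)]
    exact zero_mem _

/-- The differential of the first page is well defined: the part `d w` dies because `d ∘ d = 0`, and
the lower part has filtration `p`. -/
lemma d_mem_B_one {p : ℤ} {n : ℕ} {x : K.C.X n} (hx : x ∈ K.B 1 (p + 1) n) (m : ℕ) :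
    (K.C.d n m).hom x ∈ K.B 1 p m := by
  obtain ⟨e, he, w, -, rfl⟩ := (mem_B_one K).mp hx
  rw [map_add, d_d, add_zero]
  exact d_mem_B_one_of_F K (by simpa using he) m

lemma d_mem_B_one_of_Z_two {p : ℤ} {n : ℕ} {x : K.C.X n} (hx : x ∈ K.Z 2 (p + 1) n) (m : ℕ) :
    (K.C.d n m).hom x ∈ K.B 1 p m := by
  refine F_le_B_one K ?_
  have := ((mem_Z K).mp hx).2 m
  rwa [show p + 1 - 2 = p - 1 by ring] at this

/-- A class on the first page killed by the differential lifts to the second page. -/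
lemma exists_Z_two {p : ℤ} {n : ℕ} {x : K.C.X n} (hx : x ∈ K.Z 1 (p + 1) n)
    (hd : ∀ m, (K.C.d n m).hom x ∈ K.B 1 p m) :
    ∃ z ∈ K.Z 2 (p + 1) n, x - z ∈ K.B 1 (p + 1) n := by
  cases n with
  | zero =>
    refine ⟨x, (mem_Z K).mpr ⟨((mem_Z K).mp hx).1, fun m => ?_⟩, by simp⟩
    rw [K.C.shape 0 m (by simp)]
    exact zero_mem _
  | succ n =>
    obtain ⟨e, he, w, hw, hdx⟩ := (mem_B_one K).mp (hd n)
    -- Since `d x = e + d w` with `e` in `F_{p-1}`, the chain `x - w` has boundary `e`; and `w` in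
    -- `F_p` does not affect the class on the first page.
    refine ⟨x - w, (mem_Z K).mpr ⟨sub_mem ((mem_Z K).mp hx).1 (K.mono _ (by simp) hw),
      fun m => ?_⟩, ?_⟩
    · by_cases h : m = n
      · subst h
        rw [map_sub, ← hdx, add_sub_cancel_right, show p + 1 - 2 = p - 1 by ring]
        exact he
      · rw [K.C.shape (n + 1) m (fun h' => h (Nat.succ_injective h'))]
        exact zero_mem _
    · rw [sub_sub_cancel]
      exact F_le_B_one K (by simpa using hw)

/-- A class on the second page vanishes once it is a boundary on the first page. -/
lemma mem_B_two_of {p : ℤ} {n : ℕ} {x v : _} (hx : x ∈ K.Z 2 p n)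
    (hv : v ∈ K.Z 1 (p + 1) (n + 1)) (h : x - (K.C.d (n + 1) n).hom v ∈ K.B 1 p n) :
    x ∈ K.B 2 p n := by
  obtain ⟨e, he, w, hw, hxe⟩ := (mem_B_one K).mp h
  have hx' : e + (K.C.d (n + 1) n).hom (w + v) = x := by
    rw [map_add, ← add_assoc, hxe, sub_add_cancel]
  -- `e` has the same boundary as `x`, two steps below `p`, and `w` has filtration `p` already, so
  -- both satisfy the boundary conditions imposed by `B 2`.
  refine (mem_B_two K).mpr ⟨e, (mem_Z K).mpr ⟨he, fun m => ?_⟩, w + v, ?_, hx'⟩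
  · have : (K.C.d n m).hom e = (K.C.d n m).hom x := by rw [← hx', map_add, d_d, add_zero]
    rw [this, show p - 1 - 1 = p - 2 by ring]
    exact ((mem_Z K).mp hx).2 m
  · refine add_mem ((mem_Z K).mpr ⟨K.mono _ (by simp) hw, fun m => ?_⟩) hv
    have := K.d_mem p _ m hw
    simpa using this

lemma mem_B_two_of_B_one {p : ℤ} {n : ℕ} {x : K.C.X n} (hx : x ∈ K.Z 2 p n)
    (h : x ∈ K.B 1 p n) : x ∈ K.B 2 p n :=
  mem_B_two_of K hx (zero_mem _) (by simpa using h)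

lemma exists_of_mem_B_two {p : ℤ} {n : ℕ} {x : K.C.X n} (hx : x ∈ K.B 2 p n) :
    ∃ v ∈ K.Z 1 (p + 1) (n + 1), x - (K.C.d (n + 1) n).hom v ∈ K.B 1 p n := by
  obtain ⟨e, he, w, hw, rfl⟩ := (mem_B_two K).mp hx
  exact ⟨w, hw, by simpa using F_le_B_one K ((mem_Z K).mp he).1⟩

/-- The class of a cycle on the second page. -/
def cls (p : ℤ) (n : ℕ) : K.Z 2 p n →ₗ[R] K.Page 2 p n := Submodule.mkQ _

lemma cls_surjective (p : ℤ) (n : ℕ) : Function.Surjective (K.cls p n) :=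
  Submodule.mkQ_surjective _

lemma cls_eq_zero {p : ℤ} {n : ℕ} {x : K.Z 2 p n} :
    K.cls p n x = 0 ↔ (x : K.C.X n) ∈ K.B 2 p n := by
  rw [cls, Submodule.mkQ_apply]
  exact (Submodule.Quotient.mk_eq_zero _).trans Submodule.mem_comap

end pages

section hom

variable {K L : FilteredComplex.{v, w} R} (φ : Hom K L)

lemma Hom.comm (n m : ℕ) (x : K.C.X n) :
    (φ.f.f m).hom ((K.C.d n m).hom x) = (L.C.d n m).hom ((φ.f.f n).hom x) := by
  rw [← LinearMap.comp_apply, ← LinearMap.comp_apply, ← ModuleCat.hom_comp, ← ModuleCat.hom_comp,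
    φ.f.comm]

lemma Hom.page_cls (p : ℤ) (n : ℕ) (x : K.Z 2 p n) :
    φ.page 2 p n (K.cls p n x) = L.cls p n ⟨(φ.f.f n).hom x, φ.map_Z 2 p n x.2⟩ := rfl

lemma Hom.map_mem_Z {r p : ℤ} {n : ℕ} {x : K.C.X n} (hx : x ∈ K.Z r p n) :
    (φ.f.f n).hom x ∈ L.Z r p n := φ.map_Z r p n hx

lemma Hom.map_mem_B {r p : ℤ} {n : ℕ} {x : K.C.X n} (hx : x ∈ K.B r p n) :
    (φ.f.f n).hom x ∈ L.B r p n := φ.map_B r p n hx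

end hom

/-- A commutative square of filtered complexes whose first pages form short exact sequences
`0 → E¹(A) → E¹(X) ⊕ E¹(Y) → E¹(P) → 0`. -/
structure IsPageOneBicartesian {A X Y P : FilteredComplex.{v, w} R} (i : Hom A X) (f : Hom A Y)
    (g : Hom X P) (j : Hom Y P) : Prop where
  comm : ∀ n x, (g.f.f n).hom ((i.f.f n).hom x) = (j.f.f n).hom ((f.f.f n).hom x)
  inj : ∀ {p n} {a : A.C.X n}, a ∈ A.Z 1 p n → (i.f.f n).hom a ∈ X.B 1 p n → a ∈ A.B 1 p n
  exact : ∀ {p n} {x : X.C.X n} {y : Y.C.X n}, x ∈ X.Z 1 p n → y ∈ Y.Z 1 p n →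
    (g.f.f n).hom x + (j.f.f n).hom y ∈ P.B 1 p n →
    ∃ a ∈ A.Z 1 p n, x - (i.f.f n).hom a ∈ X.B 1 p n ∧ y + (f.f.f n).hom a ∈ Y.B 1 p n
  surj : ∀ {p n} {z : P.C.X n}, z ∈ P.Z 1 p n → ∃ x ∈ X.Z 1 p n, ∃ y ∈ Y.Z 1 p n,
    z - ((g.f.f n).hom x + (j.f.f n).hom y) ∈ P.B 1 p n

/-! ### The long exact sequence of a short exact sequence of first pages -/

namespace IsPageOneBicartesian

variable {A X Y P : FilteredComplex.{v, w} R} {i : Hom A X} {f : Hom A Y} {g : Hom X P}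
  {j : Hom Y P} (S : IsPageOneBicartesian i f g j)

lemma map_d_sub {m n : ℕ} (x : X.C.X m) (y : Y.C.X m) (z : P.C.X m) :
    (P.C.d m n).hom (z - ((g.f.f m).hom x + (j.f.f m).hom y)) =
      (P.C.d m n).hom z - ((g.f.f n).hom ((X.C.d m n).hom x) +
        (j.f.f n).hom ((Y.C.d m n).hom y)) := by
  rw [map_sub, map_add, g.comm, j.comm]

include S

/-- A first page class of `A` whose image in `X` is a cycle lifts to the second page. -/
lemma exists_Z_two {p : ℤ} {n : ℕ} {a : A.C.X n} {x : X.C.X n} (ha : a ∈ A.Z 1 p n)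
    (hx : ∀ m, (X.C.d n m).hom x ∈ X.B 1 (p - 1) m) (hxa : x - (i.f.f n).hom a ∈ X.B 1 p n) :
    ∃ a' ∈ A.Z 2 p n, a - a' ∈ A.B 1 p n := by
  obtain ⟨p, rfl⟩ : ∃ q, p = q + 1 := ⟨p - 1, by ring⟩
  simp only [add_sub_cancel_right] at hx
  -- By injectivity it is enough that `i (d a)` vanishes on the first page, and `i a` agrees there
  -- with the cycle `x`.
  refine A.exists_Z_two ha fun m => S.inj (A.d_mem_Z_one ha m) ?_
  have := sub_mem (hx m) (X.d_mem_B_one hxa m)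
  rwa [map_sub, sub_sub_cancel, ← i.comm] at this

/-- If `g x + j y` bounds `v` on the first page, lift `v` to a pair `(x', y')`. Then `(x - d x', y -
d y')` maps to zero and comes from some `a`, which is a cycle by injectivity. -/
lemma exact_middle (p : ℤ) (n : ℕ) : Function.Exact
    ((i.page 2 p n).prod (-f.page 2 p n)) ((g.page 2 p n).coprod (j.page 2 p n)) := by
  rintro ⟨ξ, η⟩
  obtain ⟨⟨x, hx⟩, rfl⟩ := X.cls_surjective p n ξ
  obtain ⟨⟨y, hy⟩, rfl⟩ := Y.cls_surjective p n η
  constructor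
  · intro h
    rw [LinearMap.coprod_apply, Hom.page_cls, Hom.page_cls, ← map_add, cls_eq_zero] at h
    obtain ⟨v, hv, hb⟩ := P.exists_of_mem_B_two h
    obtain ⟨x', hx', y', hy', hv'⟩ := S.surj hv
    have h1 := add_mem hb (P.d_mem_B_one hv' n)
    rw [map_d_sub, sub_add_sub_cancel] at h1
    simp only [AddMemClass.mk_add_mk] at h1
    rw [add_sub_add_comm, ← map_sub, ← map_sub] at h1
    obtain ⟨a, ha, hxa, hya⟩ := S.exact
      (sub_mem (X.Z_two_le_Z_one hx) (X.d_mem_Z_one hx' n))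
      (sub_mem (Y.Z_two_le_Z_one hy) (Y.d_mem_Z_one hy' n)) h1
    obtain ⟨a', ha', haa⟩ := S.exists_Z_two ha (fun m => by
      rw [map_sub, X.d_d, sub_zero]
      exact X.d_mem_B_one_of_Z_two (by simpa using hx) m) hxa
    refine ⟨A.cls p n ⟨a', ha'⟩, ?_⟩
    rw [LinearMap.prod_apply, Function.prod_apply, LinearMap.neg_apply, Hom.page_cls, Hom.page_cls]
    refine Prod.ext ?_ ?_
    · refine (sub_eq_zero.mp ?_).symm
      rw [← map_sub, cls_eq_zero]
      refine X.mem_B_two_of (Subtype.property _) hx' ?_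
      have := add_mem hxa (i.map_mem_B haa)
      rw [map_sub] at this
      convert this using 1
      simp only [AddSubgroupClass.coe_sub]
      abel
    · refine (sub_eq_zero.mp ?_).symm
      dsimp only
      rw [sub_neg_eq_add, ← map_add, cls_eq_zero]
      refine Y.mem_B_two_of (Subtype.property _) hy' ?_
      have := sub_mem hya (f.map_mem_B haa)
      rw [map_sub] at this
      convert this using 1
      simp only [Submodule.coe_add]
      abel
  · rintro ⟨α, hα⟩
    obtain ⟨⟨a, ha⟩, rfl⟩ := A.cls_surjective p n α
    rw [← hα, LinearMap.prod_apply, Function.prod_apply, LinearMap.neg_apply, LinearMap.coprod_apply, map_neg]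
    simp only [Hom.page_cls, S.comm, add_neg_cancel]

omit S in
variable (i f g j) in
/-- The relation defining the connecting map: `z = g x + j y`, `d x = i a` and `d y = - f a` on the
first page. -/
def ConnectingRel (p : ℤ) (n : ℕ) (z : P.C.X (n + 1)) (a : A.C.X n) : Prop :=
  ∃ x ∈ X.Z 1 (p + 1) (n + 1), ∃ y ∈ Y.Z 1 (p + 1) (n + 1),
    z - ((g.f.f _).hom x + (j.f.f _).hom y) ∈ P.B 1 (p + 1) (n + 1) ∧
    (X.C.d (n + 1) n).hom x - (i.f.f n).hom a ∈ X.B 1 p n ∧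
    (Y.C.d (n + 1) n).hom y + (f.f.f n).hom a ∈ Y.B 1 p n

lemma exists_connectingRel {p : ℤ} {n : ℕ} {z : P.C.X (n + 1)} (hz : z ∈ P.Z 2 (p + 1) (n + 1)) :
    ∃ a ∈ A.Z 2 p n, ConnectingRel i f g j p n z a := by
  obtain ⟨x, hx, y, hy, hxy⟩ := S.surj (P.Z_two_le_Z_one hz)
  have h1 := sub_mem (P.d_mem_B_one_of_Z_two hz n) (P.d_mem_B_one hxy n)
  rw [map_d_sub, sub_sub_cancel] at h1
  obtain ⟨a, ha, hxa, hya⟩ := S.exact (X.d_mem_Z_one hx n) (Y.d_mem_Z_one hy n) h1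
  obtain ⟨a', ha', haa⟩ := S.exists_Z_two ha (fun m => by
    rw [X.d_d]; exact zero_mem _) hxa
  refine ⟨a', ha', x, hx, y, hy, hxy, ?_, ?_⟩
  · have := add_mem hxa (i.map_mem_B haa)
    rwa [map_sub, sub_add_sub_cancel] at this
  · have := sub_mem hya (f.map_mem_B haa)
    rw [map_sub] at this
    convert this using 1
    abel

/-- Independence of the choices in the snake construction: by linearity only `z = 0` matters. After
subtracting boundaries from `x` and `y` the pair comes from some `a1`; applying `d` gives `i a = i
(d a1)` on the first page, so `a` bounds. -/
lemma mem_B_two_of_connectingRel {p : ℤ} {n : ℕ} {z : P.C.X (n + 1)} {a : A.C.X n}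
    (hz : z ∈ P.B 2 (p + 1) (n + 1)) (ha : a ∈ A.Z 2 p n) (h : ConnectingRel i f g j p n z a) :
    a ∈ A.B 2 p n := by
  obtain ⟨x, hx, y, hy, hxy, hxa, hya⟩ := h
  obtain ⟨v, hv, hzv⟩ := P.exists_of_mem_B_two hz
  obtain ⟨x0, hx0, y0, hy0, hv0⟩ := S.surj hv
  have h1 := sub_mem (add_mem hzv (P.d_mem_B_one hv0 (n + 1))) hxy
  rw [map_d_sub] at h1
  have h2 : (g.f.f (n + 1)).hom (x - (X.C.d _ _).hom x0) +
      (j.f.f (n + 1)).hom (y - (Y.C.d _ _).hom y0) ∈ P.B 1 (p + 1) (n + 1) := by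
    rw [map_sub, map_sub]
    convert h1 using 1
    abel
  obtain ⟨a1, ha1, h3, h4⟩ := S.exact (sub_mem hx (X.d_mem_Z_one hx0 (n + 1)))
    (sub_mem hy (Y.d_mem_Z_one hy0 (n + 1))) h2
  refine A.mem_B_two_of ha ha1 (S.inj (sub_mem (A.Z_two_le_Z_one ha) (A.d_mem_Z_one ha1 n)) ?_)
  have h5 := sub_mem (X.d_mem_B_one h3 n) hxa
  rw [map_sub, map_sub, X.d_d, sub_zero, ← i.comm] at h5
  rw [map_sub]
  convert h5 using 1
  abel

/-- No lifts are chosen: the related classes form a submodule `G` of the product that projects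
bijectively to the first factor, hence the graph of a linear map. The equivalence is stated for all
representatives, so that each exactness proof may take convenient ones. -/
lemma exists_connecting (p : ℤ) (n : ℕ) :
    ∃ δ : P.Page 2 (p + 1) (n + 1) →ₗ[R] A.Page 2 p n, ∀ z a,
      δ (P.cls _ _ z) = A.cls _ _ a ↔ ConnectingRel i f g j p n z.1 a.1 := by
  let G : Submodule R (P.Page 2 (p + 1) (n + 1) × A.Page 2 p n) :=
    { carrier := {t | ∃ z a, t = (P.cls _ _ z, A.cls _ _ a) ∧ ConnectingRel i f g j p n z.1 a.1}
      zero_mem' := ⟨0, 0, by simp; rfl, 0, zero_mem _, 0, zero_mem _, by simp, by simp, by simp⟩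
      add_mem' := by
        rintro _ _ ⟨z, a, rfl, x, hx, y, hy, h1, h2, h3⟩ ⟨z', a', rfl, x', hx', y', hy', h1', h2', h3'⟩
        refine ⟨z + z', a + a', by simp, x + x', add_mem hx hx', y + y', add_mem hy hy', ?_, ?_, ?_⟩
        · convert add_mem h1 h1' using 1
          simp only [Submodule.coe_add, map_add]
          abel
        · convert add_mem h2 h2' using 1
          simp only [Submodule.coe_add, map_add]
          abel
        · convert add_mem h3 h3' using 1
          simp only [Submodule.coe_add, map_add]
          abel
      smul_mem' := by
        rintro c _ ⟨z, a, rfl, x, hx, y, hy, h1, h2, h3⟩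
        refine ⟨c • z, c • a, by simp, c • x, Submodule.smul_mem _ c hx, c • y,
          Submodule.smul_mem _ c hy, ?_, ?_, ?_⟩
        · convert Submodule.smul_mem _ c h1 using 1
          simp [smul_sub]
        · convert Submodule.smul_mem _ c h2 using 1
          simp [smul_sub]
        · convert Submodule.smul_mem _ c h3 using 1
          simp }
  have hzero : ∀ z a, (P.cls (p + 1) (n + 1) z, A.cls p n a) ∈ G → P.cls _ _ z = 0 →
      A.cls _ _ a = 0 := by
    rintro z a ⟨z', a', h, hr⟩ hz
    rw [Prod.mk.injEq] at h
    rw [h.1, cls_eq_zero] at hz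
    rw [h.2, cls_eq_zero]
    exact S.mem_B_two_of_connectingRel hz a'.2 hr
  have hbij : Function.Bijective (Prod.fst ∘ G.subtype) := by
    constructor
    · have hinj : Function.Injective (LinearMap.fst R _ _ ∘ₗ G.subtype) := by
        rw [← LinearMap.ker_eq_bot, LinearMap.ker_eq_bot']
        rintro ⟨⟨ζ, α⟩, hm⟩ h0
        obtain ⟨z, rfl⟩ := P.cls_surjective _ _ ζ
        obtain ⟨a, rfl⟩ := A.cls_surjective _ _ α
        exact Subtype.ext (Prod.ext h0 (hzero z a hm h0))
      exact hinj
    · intro ζ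
      obtain ⟨z, rfl⟩ := P.cls_surjective _ _ ζ
      obtain ⟨a, ha, h⟩ := S.exists_connectingRel z.2
      exact ⟨⟨(P.cls _ _ z, A.cls _ _ ⟨a, ha⟩), z, ⟨a, ha⟩, rfl, h⟩, rfl⟩
  obtain ⟨δ, hδ⟩ := Submodule.exists_eq_graph hbij
  have key : ∀ z a, δ (P.cls _ _ z) = A.cls _ _ a ↔ (P.cls _ _ z, A.cls _ _ a) ∈ G := by
    intro z a
    rw [hδ, LinearMap.mem_graph_iff]
    exact eq_comm
  refine ⟨δ, fun z a => (key z a).trans ⟨?_, fun h => ⟨z, a, rfl, h⟩⟩⟩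
  -- Membership in `G` only relates some representatives `z'`, `a'` of the two classes; the relation
  -- has to be moved to `z`, `a`.
  rintro ⟨z', a', h, x, hx, y, hy, h1, h2, h3⟩
  rw [Prod.mk.injEq, ← sub_eq_zero, ← map_sub, cls_eq_zero, ← sub_eq_zero (a := A.cls _ _ a),
    ← map_sub, cls_eq_zero] at h
  obtain ⟨v, hv, hzv⟩ := P.exists_of_mem_B_two h.1
  obtain ⟨x0, hx0, y0, hy0, hv0⟩ := S.surj hv
  obtain ⟨b, hb, hab⟩ := A.exists_of_mem_B_two h.2
  have h4 := add_mem h1 (add_mem hzv (P.d_mem_B_one hv0 (n + 1)))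
  rw [map_d_sub] at h4
  -- `d x0` and `d y0` absorb the change of `z`. The chain `b` absorbs the change of `a`; it enters
  -- with opposite signs, so its two images cancel in `P`.
  refine ⟨x + (X.C.d _ _).hom x0 + (i.f.f _).hom b,
    add_mem (add_mem hx (X.d_mem_Z_one hx0 _)) (i.map_mem_Z hb),
    y + (Y.C.d _ _).hom y0 - (f.f.f _).hom b,
    sub_mem (add_mem hy (Y.d_mem_Z_one hy0 _)) (f.map_mem_Z hb), ?_, ?_, ?_⟩
  · convert h4 using 1
    simp only [map_add, map_sub, S.comm, AddSubgroupClass.coe_sub]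
    abel
  · convert sub_mem h2 (i.map_mem_B hab) using 1
    simp only [map_add, map_sub, X.d_d, i.comm, AddSubgroupClass.coe_sub]
    abel
  · convert add_mem h3 (f.map_mem_B hab) using 1
    simp only [map_add, map_sub, Y.d_d, f.comm, AddSubgroupClass.coe_sub]
    abel

omit S in
lemma exact_right {p : ℤ} {n : ℕ} {δ : P.Page 2 (p + 1) (n + 1) →ₗ[R] A.Page 2 p n}
    (hδ : ∀ z a, δ (P.cls _ _ z) = A.cls _ _ a ↔ ConnectingRel i f g j p n z.1 a.1) :
    Function.Exact ((g.page 2 (p + 1) (n + 1)).coprod (j.page 2 (p + 1) (n + 1))) δ := by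
  intro ζ
  obtain ⟨⟨z, hz⟩, rfl⟩ := P.cls_surjective _ _ ζ
  -- With `0` representing the zero class, the relation says that `d x` and `d y` themselves vanish
  -- on the first page, so `x` and `y` lift to the second.
  rw [show (0 : A.Page 2 p n) = A.cls p n 0 from (map_zero _).symm, hδ]
  constructor
  · rintro ⟨x, hx, y, hy, h1, h2, h3⟩
    simp only [ZeroMemClass.coe_zero, map_zero, sub_zero, add_zero] at h2 h3
    have aux : ∀ (K : FilteredComplex.{v, w} R) {x : K.C.X (n + 1)},
        (K.C.d (n + 1) n).hom x ∈ K.B 1 p n → ∀ m, (K.C.d (n + 1) m).hom x ∈ K.B 1 p m := by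
      intro K x hx m
      by_cases h : m = n
      · exact h ▸ hx
      · rw [K.C.shape (n + 1) m (fun h' => h (Nat.succ_injective h'))]
        exact zero_mem _
    obtain ⟨x', hx', hxx⟩ := X.exists_Z_two hx (aux X h2)
    obtain ⟨y', hy', hyy⟩ := Y.exists_Z_two hy (aux Y h3)
    refine ⟨(X.cls _ _ ⟨x', hx'⟩, Y.cls _ _ ⟨y', hy'⟩), (sub_eq_zero.mp ?_).symm⟩
    rw [LinearMap.coprod_apply, Hom.page_cls, Hom.page_cls, ← map_add, ← map_sub, cls_eq_zero]
    refine P.mem_B_two_of_B_one (Subtype.property _) ?_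
    convert add_mem h1 (add_mem (g.map_mem_B hxx) (j.map_mem_B hyy)) using 1
    simp only [map_sub, Submodule.coe_add, AddSubgroupClass.coe_sub]
    abel
  · rintro ⟨⟨ξ, η⟩, h⟩
    obtain ⟨⟨x, hx⟩, rfl⟩ := X.cls_surjective _ _ ξ
    obtain ⟨⟨y, hy⟩, rfl⟩ := Y.cls_surjective _ _ η
    rw [LinearMap.coprod_apply, Hom.page_cls, Hom.page_cls, ← map_add] at h
    rw [← hδ, ← h, hδ]
    exact ⟨x, X.Z_two_le_Z_one hx, y, Y.Z_two_le_Z_one hy, by simp,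
      by simpa using X.d_mem_B_one_of_Z_two hx n, by simpa using Y.d_mem_B_one_of_Z_two hy n⟩

/-- If `i a` bounds `x` and `f a` bounds `y`, then `g x - j y` is a cycle on the first page because
`g ∘ i = j ∘ f`, and its class is sent to that of `a`. -/
lemma exact_left {p : ℤ} {n : ℕ} {δ : P.Page 2 (p + 1) (n + 1) →ₗ[R] A.Page 2 p n}
    (hδ : ∀ z a, δ (P.cls _ _ z) = A.cls _ _ a ↔ ConnectingRel i f g j p n z.1 a.1) :
    Function.Exact δ ((i.page 2 p n).prod (-f.page 2 p n)) := by
  intro α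
  obtain ⟨⟨a, ha⟩, rfl⟩ := A.cls_surjective _ _ α
  rw [LinearMap.prod_apply, Function.prod_apply, LinearMap.neg_apply, Hom.page_cls, Hom.page_cls,
    Prod.mk_eq_zero, neg_eq_zero, cls_eq_zero, cls_eq_zero]
  constructor
  · rintro ⟨hia, hfa⟩
    obtain ⟨x, hx, h2⟩ := X.exists_of_mem_B_two hia
    obtain ⟨y, hy, h3⟩ := Y.exists_of_mem_B_two hfa
    have h1 := add_mem (g.map_mem_B h2) (neg_mem (j.map_mem_B h3))
    rw [map_sub, map_sub, S.comm, g.comm, j.comm] at h1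
    obtain ⟨z, hz, hzz⟩ := P.exists_Z_two (x := (g.f.f _).hom x - (j.f.f _).hom y)
      (sub_mem (g.map_mem_Z hx) (j.map_mem_Z hy)) (fun m => by
        by_cases h : m = n
        · subst h
          convert neg_mem h1 using 1
          rw [map_sub]
          abel
        · rw [P.C.shape (n + 1) m (fun h' => h (Nat.succ_injective h'))]
          exact zero_mem _)
    refine ⟨P.cls _ _ ⟨z, hz⟩, (hδ _ _).mpr ⟨x, hx, -y, neg_mem hy, ?_, ?_, ?_⟩⟩
    · convert neg_mem hzz using 1
      rw [map_neg]
      abel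
    · convert neg_mem h2 using 1
      abel
    · convert h3 using 1
      rw [map_neg]
      abel
  · rintro ⟨ζ, h⟩
    obtain ⟨⟨z, hz⟩, rfl⟩ := P.cls_surjective _ _ ζ
    obtain ⟨x, hx, y, hy, -, h2, h3⟩ := (hδ _ _).mp h
    refine ⟨X.mem_B_two_of (Subtype.property _) hx ?_,
      Y.mem_B_two_of (Subtype.property _) (neg_mem hy) ?_⟩
    · convert neg_mem h2 using 1
      abel
    · convert h3 using 1
      rw [map_neg]
      abel

lemma surjective_zero (p : ℤ) :
    Function.Surjective ((g.page 2 p 0).coprod (j.page 2 p 0)) := by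
  intro ζ
  obtain ⟨⟨z, hz⟩, rfl⟩ := P.cls_surjective _ _ ζ
  have aux : ∀ (K : FilteredComplex.{v, w} R) {x : K.C.X 0}, x ∈ K.Z 1 p 0 → x ∈ K.Z 2 p 0 := by
    intro K x hx
    refine (mem_Z K).mpr ⟨((mem_Z K).mp hx).1, fun m => ?_⟩
    rw [K.C.shape 0 m (by simp)]
    exact zero_mem _
  obtain ⟨x, hx, y, hy, h⟩ := S.surj (P.Z_two_le_Z_one hz)
  refine ⟨(X.cls _ _ ⟨x, aux X hx⟩, Y.cls _ _ ⟨y, aux Y hy⟩), (sub_eq_zero.mp ?_).symm⟩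
  rw [LinearMap.coprod_apply, Hom.page_cls, Hom.page_cls, ← map_add, ← map_sub, cls_eq_zero]
  exact P.mem_B_two_of_B_one (Subtype.property _) h

end IsPageOneBicartesian

end FilteredComplex

/-! ### Finite distances and lengths of faces -/

namespace DiGraph

section distance

variable {G : DiGraph.{u}}

lemma HasPath.dist_le {n : ℕ} {x y : G.V} (p : G.HasPath n x y) : G.dist x y ≤ n :=
  iInf₂_le n p

lemma Reach.exists_hasPath {x y : G.V} (h : G.Reach x y) :
    ∃ n, G.HasPath n x y ∧ G.dist x y = n := by
  classical
  refine ⟨Nat.find h, Nat.find_spec h, le_antisymm (Nat.find_spec h).dist_le ?_⟩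
  exact le_iInf₂ fun n p => by exact_mod_cast Nat.find_min' h p

/-- The distance as a natural number, meaningful between vertices joined by a path. -/
noncomputable def ndist (G : DiGraph.{u}) (x y : G.V) : ℕ := (G.dist x y).toNat

lemma Reach.dist_eq {x y : G.V} (h : G.Reach x y) : G.dist x y = G.ndist x y := by
  obtain ⟨n, -, hn⟩ := h.exists_hasPath
  simp [ndist, hn]

lemma reach_of_dist_ne_top {x y : G.V} (h : G.dist x y ≠ ⊤) : G.Reach x y := by
  by_contra hr
  refine h ?_
  simp only [Reach, not_exists] at hr
  simp [dist, hr]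

lemma Reach.hasPath_ndist {x y : G.V} (h : G.Reach x y) : G.HasPath (G.ndist x y) x y := by
  obtain ⟨n, p, hn⟩ := h.exists_hasPath
  simpa [ndist, hn] using p

lemma HasPath.ndist_le {n : ℕ} {x y : G.V} (p : G.HasPath n x y) : G.ndist x y ≤ n := by
  have := p.dist_le
  rw [Reach.dist_eq ⟨n, p⟩] at this
  exact_mod_cast this

lemma ndist_triangle {x y z : G.V} (h : G.Reach x y) (h' : G.Reach y z) :
    G.ndist x z ≤ G.ndist x y + G.ndist y z :=
  (h.hasPath_ndist.trans h'.hasPath_ndist).ndist_le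

lemma ndist_self (x : G.V) : G.ndist x x = 0 := by simp [ndist, dist_self]

lemma Reach.eq_of_ndist_eq_zero {x y : G.V} (h : G.Reach x y) (h0 : G.ndist x y = 0) : x = y := by
  have := h.hasPath_ndist
  rw [h0] at this
  cases this
  rfl

lemma ndist_map_le {H : DiGraph.{u}} (f : G ⟶ H) {x y : G.V} (h : G.Reach x y) :
    H.ndist (f.toFun x) (f.toFun y) ≤ G.ndist x y := by
  obtain ⟨m, hm, p⟩ := h.hasPath_ndist.map f
  exact p.ndist_le.trans hm

/-- The length of a tuple as a natural number. -/
noncomputable def nlength (G : DiGraph.{u}) {k : ℕ} (x : Fin (k + 1) → G.V) : ℕ :=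
  ∑ i : Fin k, G.ndist (x i.castSucc) (x i.succ)

lemma IsReach.length_eq {k : ℕ} {x : Fin (k + 1) → G.V} (h : G.IsReach x) :
    G.length x = G.nlength x := by
  rw [length, nlength, Nat.cast_sum]
  exact Finset.sum_congr rfl fun i _ => (h i).dist_eq

lemma nlength_cons {k : ℕ} (x : Fin (k + 2) → G.V) :
    G.nlength (k := k + 1) x = G.ndist (x 0) (x 1) + G.nlength (k := k) (Fin.tail x) := by
  simp only [nlength, Fin.sum_univ_succ (n := k)]
  rfl

lemma nlength_removeNth_zero {k : ℕ} (x : Fin (k + 2) → G.V) :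
    G.nlength (k := k + 1) x = G.ndist (x 0) (x 1) + G.nlength (k := k) (Fin.removeNth 0 x) := by
  rw [Fin.removeNth_zero, nlength_cons]

lemma nlength_removeNth_last {k : ℕ} (x : Fin (k + 2) → G.V) :
    G.nlength (k := k + 1) x = G.nlength (k := k) (Fin.removeNth (Fin.last _) x) +
      G.ndist (x (Fin.last k).castSucc) (x (Fin.last (k + 1))) := by
  rw [Fin.removeNth_last]
  simp only [nlength, Fin.sum_univ_castSucc (n := k)]
  rfl

/-- One distance replaces two; written additively to avoid subtraction of natural numbers. -/
lemma nlength_removeNth_interior {k : ℕ} (x : Fin (k + 2) → G.V) (e : Fin k) :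
    G.nlength (k := k + 1) x + G.ndist (x e.castSucc.castSucc) (x e.succ.succ) =
      G.nlength (k := k) (Fin.removeNth e.succ.castSucc x) +
        G.ndist (x e.castSucc.castSucc) (x e.succ.castSucc) +
        G.ndist (x e.succ.castSucc) (x e.succ.succ) := by
  induction k with
  | zero => exact e.elim0
  | succ k ih =>
    rw [nlength_cons, nlength_cons (Fin.removeNth _ x)]
    induction e using Fin.cases with
    | zero =>
      have h1 : Fin.tail (Fin.removeNth (Fin.succ 0).castSucc x) =
          Fin.tail (n := k + 1) (Fin.tail x) := by
        funext b
        simp [Fin.tail, Fin.removeNth, Fin.succAbove, Fin.lt_def]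
      rw [nlength_cons (Fin.tail x), h1]
      have h2 : Fin.removeNth (Fin.succ 0).castSucc x 0 = x 0 := rfl
      have h3 : Fin.removeNth (Fin.succ 0).castSucc x 1 = x 2 := by
        simp [Fin.removeNth, Fin.succAbove]
      rw [h2, h3]
      have h4 : Fin.tail x 0 = x 1 := rfl
      have h5 : Fin.tail x 1 = x 2 := rfl
      rw [h4, h5]
      have h6 : x (Fin.castSucc (Fin.castSucc (0 : Fin (k + 1)))) = x 0 := rfl
      have h7 : x (Fin.castSucc (Fin.succ (0 : Fin (k + 1)))) = x 1 := rfl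
      have h8 : x (Fin.succ (Fin.succ (0 : Fin (k + 1)))) = x 2 := rfl
      rw [h6, h7, h8]
      ring
    | succ e =>
      have h1 : Fin.tail (Fin.removeNth e.succ.succ.castSucc x) =
          Fin.removeNth e.succ.castSucc (Fin.tail (n := k + 2) x) := by
        funext b
        simp [Fin.tail, Fin.removeNth]
      have h2 : Fin.removeNth e.succ.succ.castSucc x 0 = x 0 := rfl
      have h3 : Fin.removeNth e.succ.succ.castSucc x 1 = x 1 := rfl
      have h4 := ih (Fin.tail x) e
      rw [h1, h2, h3]
      have h6 : Fin.tail x e.castSucc.castSucc = x e.succ.castSucc.castSucc := rfl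
      have h7 : Fin.tail x e.succ.castSucc = x e.succ.succ.castSucc := rfl
      have h8 : Fin.tail x e.succ.succ = x e.succ.succ.succ := rfl
      rw [h6, h7, h8] at h4
      omega

lemma IsReach.nlength_removeNth_le {k : ℕ} {x : Fin (k + 2) → G.V} (h : G.IsReach (k := k + 1) x)
    (i : Fin (k + 2)) : G.nlength (k := k) (i.removeNth x) ≤ G.nlength (k := k + 1) x := by
  have := length_removeNth_le G x i
  rw [h.length_eq, (h.removeNth i).length_eq] at this
  exact_mod_cast this

lemma IsReach.nlength_map_le {H : DiGraph.{u}} (f : G ⟶ H) {k : ℕ} {x : Fin (k + 1) → G.V}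
    (h : G.IsReach x) : H.nlength (f.toFun ∘ x) ≤ G.nlength x :=
  Finset.sum_le_sum fun i _ => ndist_map_le f (h i)

lemma IsGen.ndist_pos {k : ℕ} {x : Fin (k + 1) → G.V} (h : G.IsGen x) (i : Fin k) :
    0 < G.ndist (x i.castSucc) (x i.succ) :=
  Nat.pos_of_ne_zero fun h0 => (h i).1 ((h i).2.eq_of_ndist_eq_zero h0)

/-- A face of a generator of the same length omits an interior vertex, which lies on a shortest
path between its neighbours. -/
lemma IsGen.interior_of_nlength_eq {k : ℕ} {x : Fin (k + 2) → G.V} (h : G.IsGen (k := k + 1) x)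
    {i : Fin (k + 2)} (hi : G.nlength (k := k) (i.removeNth x) = G.nlength (k := k + 1) x) :
    ∃ e : Fin k, i = e.succ.castSucc ∧ G.ndist (x e.castSucc.castSucc) (x e.succ.succ) =
      G.ndist (x e.castSucc.castSucc) (x e.succ.castSucc) +
        G.ndist (x e.succ.castSucc) (x e.succ.succ) := by
  -- Omitting an end of the tuple loses a positive distance.
  have h0 : i ≠ 0 := by
    rintro rfl
    have h1 := nlength_removeNth_zero x
    have h2 := h.ndist_pos 0
    simp only [Fin.castSucc_zero, Fin.succ_zero_eq_one] at h2
    omega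
  have hl : i ≠ Fin.last (k + 1) := by
    rintro rfl
    have h1 := nlength_removeNth_last x
    have h2 : 0 < G.ndist (x (Fin.last k).castSucc) (x (Fin.last (k + 1))) :=
      h.ndist_pos (Fin.last k)
    omega
  have h0' : (i : ℕ) ≠ 0 := fun h => h0 (Fin.ext h)
  have hl' : (i : ℕ) ≠ k + 1 := fun h => hl (Fin.ext h)
  obtain ⟨e, rfl⟩ : ∃ e : Fin k, i = e.succ.castSucc :=
    ⟨⟨i - 1, by omega⟩, Fin.ext (by simp; omega)⟩
  refine ⟨e, rfl, ?_⟩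
  have := nlength_removeNth_interior x e
  omega

end distance

/-! ### Projections, crossings and detours -/

section projection

variable {G : DiGraph.{u}} {S : Set G.V}

/-- `p` is the vertex of `S` through which every vertex of `S` reaches `x`. -/
structure IsProj (G : DiGraph.{u}) (S : Set G.V) (p x : G.V) : Prop where
  mem : p ∈ S
  reach : G.Reach p x
  reach_of_reach : ∀ s ∈ S, G.Reach s x → G.Reach s p
  ndist_eq : ∀ s ∈ S, G.Reach s x → G.ndist s x = G.ndist s p + G.ndist p x

/-- Expand `d(q, z) = d(q, p) + d(p, x) + d(x, z)` with `d(p, x) = d(p, q) + d(q, x)` and compare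
with `d(q, z) ≤ d(q, x) + d(x, z)`: both `d(p, q)` and `d(q, p)` vanish. This keeps a detour from
becoming direct when a vertex on a shortest path is omitted. -/
lemma IsProj.eq_of_geodesic {p q x z : G.V} (hp : G.IsProj S p z) (hq : G.IsProj S q x)
    (hpx : G.Reach p x) (hxz : G.Reach x z)
    (h : G.ndist p z = G.ndist p x + G.ndist x z) : p = q := by
  have hqz := hq.reach.trans hxz
  have h1 := hp.ndist_eq q hq.mem hqz
  have h2 := hq.ndist_eq p hp.mem hpx
  have h3 := ndist_triangle hq.reach hxz
  exact (hq.reach_of_reach p hp.mem hpx).eq_of_ndist_eq_zero (by omega)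

lemma IsProj.unique {p q x : G.V} (hp : G.IsProj S p x) (hq : G.IsProj S q x) : p = q :=
  hp.eq_of_geodesic hq hp.reach (Reach.refl x) (by rw [ndist_self, add_zero])

lemma isProj_self {x : G.V} (hx : x ∈ S) : G.IsProj S x x :=
  ⟨hx, Reach.refl x, fun _ _ h => h, fun _ _ _ => by rw [ndist_self, add_zero]⟩

/-- The vertex set of a cofibration. -/
structure IsProjective (G : DiGraph.{u}) (S : Set G.V) : Prop where
  mem_of_reach : ∀ {x s}, s ∈ S → G.Reach x s → x ∈ S
  exists_isProj : ∀ {s x}, s ∈ S → G.Reach s x → ∃ p, G.IsProj S p x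

/-- The tuple leaves `S` between the positions `c` and `c + 1`. -/
def Cross (S : Set G.V) {k : ℕ} (x : Fin (k + 1) → G.V) (c : Fin k) : Prop :=
  x c.castSucc ∈ S ∧ x c.succ ∉ S

/-- The tuple leaves `S` after the position `c`, and either has at least two entries in `S` or its
single entry in `S` is not the projection of its successor. -/
def DetourAt (G : DiGraph.{u}) (S : Set G.V) {k : ℕ} (x : Fin (k + 1) → G.V) (c : Fin k) : Prop :=
  Cross S x c ∧ (0 < (c : ℕ) ∨ ¬ G.IsProj S (x c.castSucc) (x c.succ))

/-- The tuples that span the acyclic part of the chains not contained in `S`. -/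
def Detour (G : DiGraph.{u}) (S : Set G.V) {k : ℕ} (x : Fin (k + 1) → G.V) : Prop :=
  ∃ c, G.DetourAt S x c

variable (hS : G.IsProjective S)

include hS

/-- So the entries in `S` form an initial segment, which a tuple leaves at most once. -/
lemma IsProjective.mem_of_le {k : ℕ} {x : Fin (k + 1) → G.V} (hx : G.IsReach x)
    {a b : Fin (k + 1)} (hab : a ≤ b) (hb : x b ∈ S) : x a ∈ S :=
  hS.mem_of_reach hb (hx.reach_of_le hab)

lemma IsProjective.cross_unique {k : ℕ} {x : Fin (k + 1) → G.V} (hx : G.IsReach x) {c c' : Fin k}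
    (h : Cross S x c) (h' : Cross S x c') : c = c' := by
  by_contra hne
  rcases lt_or_gt_of_ne hne with hlt | hlt
  · exact h.2 (hS.mem_of_le hx (Fin.succ_le_castSucc_iff.mpr hlt) h'.1)
  · exact h'.2 (hS.mem_of_le hx (Fin.succ_le_castSucc_iff.mpr hlt) h.1)

lemma IsProjective.last_notMem {k : ℕ} {x : Fin (k + 1) → G.V} (hx : G.IsReach x)
    (h : G.Detour S x) : x (Fin.last k) ∉ S := by
  obtain ⟨c, hc, -⟩ := h
  exact fun hl => hc.2 (hS.mem_of_le hx (Fin.le_last _) hl)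

omit hS in
lemma cross_removeNth_of_lt {k : ℕ} {x : Fin (k + 2) → G.V} {e : Fin k}
    (h : Cross S (k := k + 1) x e.succ) {i : Fin (k + 2)} (hi : (i : ℕ) ≤ e) :
    Cross S (k := k) (i.removeNth x) e ∧ i.removeNth x e.castSucc = x e.succ.castSucc ∧
      i.removeNth x e.succ = x e.succ.succ := by
  have h1 : i.removeNth x e.castSucc = x e.succ.castSucc := by
    rw [Fin.removeNth_apply, Fin.succAbove_of_le_castSucc _ _ (by simpa [Fin.le_def] using hi)]
    rfl
  have h2 : i.removeNth x e.succ = x e.succ.succ := by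
    rw [Fin.removeNth_apply,
      Fin.succAbove_of_le_castSucc _ _ (by simp [Fin.le_def]; omega)]
  exact ⟨⟨h1 ▸ h.1, h2 ▸ h.2⟩, h1, h2⟩

/-- The omitted entry may be the first one outside `S`; its successor is then outside as well, since
the entries in `S` form an initial segment. -/
lemma IsProjective.cross_removeNth_of_gt {k : ℕ} {x : Fin (k + 2) → G.V}
    (hx : G.IsReach (k := k + 1) x) {e : Fin k} (h : Cross S (k := k + 1) x e.castSucc)
    {i : Fin (k + 2)} (hi : (e : ℕ) < i) :
    Cross S (k := k) (i.removeNth x) e ∧ i.removeNth x e.castSucc = x e.castSucc.castSucc := by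
  have h1 : i.removeNth x e.castSucc = x e.castSucc.castSucc := by
    rw [Fin.removeNth_apply, Fin.succAbove_of_castSucc_lt _ _ (by simpa [Fin.lt_def] using hi)]
  refine ⟨⟨h1 ▸ h.1, fun hm => h.2 ?_⟩, h1⟩
  rw [Fin.removeNth_apply] at hm
  refine hS.mem_of_le hx ?_ hm
  rw [Fin.le_def]
  simp only [Fin.succAbove, Fin.lt_def, apply_ite Fin.val, Fin.val_castSucc, Fin.val_succ]
  split_ifs <;> omega

omit hS in
lemma removeNth_succ_castSucc {k : ℕ} (x : Fin (k + 2) → G.V) (e : Fin k) :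
    e.succ.castSucc.removeNth x e.castSucc = x e.castSucc.castSucc ∧
      e.succ.castSucc.removeNth x e.succ = x e.succ.succ := by
  constructor
  · rw [Fin.removeNth_apply, Fin.succAbove_of_castSucc_lt _ _
      (Fin.castSucc_lt_castSucc_iff.mpr Fin.castSucc_lt_succ)]
  · rw [Fin.removeNth_apply, Fin.succAbove_of_le_castSucc _ _ (by simp)]

/-- Faces of the same length of a detour are detours. -/
lemma IsProjective.detourAt_removeNth {k : ℕ} {x : Fin (k + 2) → G.V}
    (hx : G.IsGen (k := k + 1) x) {c : Fin (k + 1)} (h : G.DetourAt S (k := k + 1) x c)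
    {i : Fin (k + 2)} (hi : G.nlength (k := k) (i.removeNth x) = G.nlength (k := k + 1) x) :
    ∃ e, G.DetourAt S (k := k) (i.removeNth x) e ∧ (c : ℕ) ≤ e + 1 := by
  obtain ⟨e, rfl, hg⟩ := hx.interior_of_nlength_eq hi
  obtain ⟨hc, hc'⟩ := h
  obtain ⟨hv1, hv2⟩ := removeNth_succ_castSucc x e
  have hr1 : G.Reach (x e.castSucc.castSucc) (x e.succ.castSucc) := (hx e.castSucc).2
  have hr2 : G.Reach (x e.succ.castSucc) (x e.succ.succ) := (hx e.succ).2
  have hne : x e.castSucc.castSucc ≠ x e.succ.castSucc := (hx e.castSucc).1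
  rcases lt_trichotomy (c : ℕ) (e + 1 : ℕ) with hlt | heq | hgt
  · obtain ⟨c, rfl⟩ : ∃ c' : Fin k, c = c'.castSucc := ⟨⟨c, by omega⟩, rfl⟩
    simp only [Fin.val_castSucc] at hlt
    obtain ⟨h1, h2⟩ := hS.cross_removeNth_of_gt hx.isReach hc (i := e.succ.castSucc)
      (by simpa using hlt)
    refine ⟨c, ⟨h1, ?_⟩, by simp⟩
    rcases hc' with hc' | hc'
    · exact Or.inl hc'
    · refine Or.inr fun hp => hc' ?_
      -- The successor of the crossing entry changes only if the first vertex outside `S` is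
      -- omitted. A projection of the vertex after it would then, along the shortest path, be a
      -- projection of the omitted one too.
      rcases (Nat.lt_succ_iff.mp hlt).lt_or_eq with hlt' | heq'
      · have h3 : e.succ.castSucc.removeNth x c.succ = x c.castSucc.succ := by
          rw [Fin.removeNth_apply, Fin.succAbove_of_castSucc_lt _ _
            (Fin.castSucc_lt_castSucc_iff.mpr (Fin.succ_lt_succ_iff.mpr hlt'))]
          rfl
        rwa [h2, h3] at hp
      · obtain rfl : c = e := Fin.ext heq'
        rw [hv1, hv2] at hp
        obtain ⟨q, hq⟩ := hS.exists_isProj hp.mem hr1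
        obtain rfl := hp.eq_of_geodesic hq hr1 hr2 hg
        exact hq
  -- The last entry in `S` is omitted. If its predecessor were now a projection, the shortest path
  -- through the omitted entry, which is its own projection, would make the two equal.
  · obtain rfl : c = e.succ := Fin.ext (by simpa using heq)
    refine ⟨e, ⟨⟨?_, ?_⟩, ?_⟩, by simp⟩
    · rw [hv1]
      exact hS.mem_of_reach hc.1 hr1
    · rw [hv2]
      exact hc.2
    · refine Or.inr fun hp => ?_
      rw [hv1, hv2] at hp
      exact hne (hp.eq_of_geodesic (isProj_self hc.1) hr1 hr2 hg)
  -- An earlier entry of `S` is omitted; at least two entries in `S` remain.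
  · obtain ⟨c, rfl⟩ : ∃ c' : Fin k, c = c'.succ := ⟨⟨c - 1, by omega⟩, Fin.ext (by simp; omega)⟩
    simp only [Fin.val_succ] at hgt
    exact ⟨c, ⟨(cross_removeNth_of_lt hc (by simp; omega)).1, Or.inl (by omega)⟩, by simp⟩

end projection

end DiGraph

namespace DiGraph

/-! ### Chains with prescribed generators -/

section supported

variable (R : Type v) [CommRing R] {G H : DiGraph.{u}}

/-- The chains spanned by the generators with a given property. -/
abbrev chains (G : DiGraph.{u}) (k : ℕ) (s : (Fin (k + 1) → G.V) → Prop) : Submodule R (RC R G k) :=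
  Finsupp.supported R R {x | s x.1}

variable {R}

lemma chains_mono {k : ℕ} {s t : (Fin (k + 1) → G.V) → Prop} (h : ∀ x, G.IsGen x → s x → t x) :
    chains R G k s ≤ chains R G k t :=
  Finsupp.supported_mono fun x hx => h x.1 x.2 hx

lemma genOrZero_mem_chains {k : ℕ} {s : (Fin (k + 1) → G.V) → Prop} {x : Fin (k + 1) → G.V}
    (h : G.IsGen x → s x) : genOrZero R G x ∈ chains R G k s := by
  by_cases hx : G.IsGen x
  · rw [genOrZero_of_isGen R hx]
    exact Finsupp.single_mem_supported R 1 (h hx)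
  · rw [genOrZero, dif_neg hx]
    exact zero_mem _

lemma of_mem_chains {k : ℕ} {s : (Fin (k + 1) → G.V) → Prop} {c : RC R G k}
    (hc : c ∈ chains R G k s) {x : G.Gen k} (hx : c x ≠ 0) : s x.1 :=
  hc (Finsupp.mem_support_iff.mpr hx)

lemma single_mem_chains {k : ℕ} {s : (Fin (k + 1) → G.V) → Prop} {x : Fin (k + 1) → G.V}
    (hx : G.IsGen x) (h : s x) : Finsupp.single ⟨x, hx⟩ 1 ∈ chains R G k s :=
  Finsupp.single_mem_supported R 1 h

lemma chains_le_iff {k : ℕ} {s : (Fin (k + 1) → G.V) → Prop} {M : Submodule R (RC R G k)} :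
    chains R G k s ≤ M ↔ ∀ x (h : G.IsGen x), s x → Finsupp.single ⟨x, h⟩ 1 ∈ M := by
  rw [chains, Finsupp.supported_eq_span_single, Submodule.span_le]
  exact ⟨fun h x hx hs => h ⟨⟨x, hx⟩, hs, rfl⟩, by
    rintro h _ ⟨x, hx, rfl⟩
    exact h x.1 x.2 hx⟩

lemma mem_chains_or {k : ℕ} {s t : (Fin (k + 1) → G.V) → Prop} {c : RC R G k} :
    c ∈ chains R G k (fun x => s x ∨ t x) ↔
      ∃ a ∈ chains R G k s, ∃ b ∈ chains R G k t, a + b = c := by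
  rw [← Submodule.mem_sup, ← Finsupp.supported_union]
  rfl

lemma mem_chains_and {k : ℕ} {s t : (Fin (k + 1) → G.V) → Prop} {c : RC R G k}
    (hs : c ∈ chains R G k s) (ht : c ∈ chains R G k t) :
    c ∈ chains R G k (fun x => s x ∧ t x) := fun _ hx => ⟨hs hx, ht hx⟩

lemma chains_eq_zero {k : ℕ} {s : (Fin (k + 1) → G.V) → Prop} {c : RC R G k}
    (hs : c ∈ chains R G k s) (h : ∀ x, G.IsGen x → ¬ s x) : c = 0 := by
  ext x
  exact (Finsupp.mem_supported' R c).mp hs x (h x.1 x.2)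

lemma boundary_single {k : ℕ} (x : G.Gen (k + 1)) :
    boundary R G k (Finsupp.single x 1) =
      ∑ i : Fin (k + 2), (-1 : R) ^ (i : ℕ) • genOrZero R G (k := k) (i.removeNth x.1) := by
  simp [boundary]

lemma genOrZero_apply_of_ne {k : ℕ} {x : Fin (k + 1) → G.V} {z : G.Gen k} (h : x ≠ z.1) :
    genOrZero R G x z = 0 := by
  by_cases hx : G.IsGen x
  · rw [genOrZero_of_isGen R hx, Finsupp.single_eq_of_ne]
    exact fun he => h (congrArg Subtype.val he).symm
  · rw [genOrZero, dif_neg hx]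
    rfl

lemma single_sub_boundary_mem {k : ℕ} {y : G.Gen (k + 1)} {i : Fin (k + 2)} {z : G.Gen k}
    (hz : i.removeNth y.1 = z.1) {M : Submodule R (RC R G k)}
    (h : ∀ b ≠ i, genOrZero R G (k := k) (b.removeNth y.1) ∈ M) :
    Finsupp.single z 1 - boundary R G k ((-1 : R) ^ (i : ℕ) • Finsupp.single y 1) ∈ M := by
  have hsgn : (-1 : R) ^ (i : ℕ) * (-1 : R) ^ (i : ℕ) = 1 := by
    rw [← pow_add, Even.neg_one_pow ⟨_, rfl⟩]
  rw [map_smul, boundary_single, ← Finset.add_sum_erase _ _ (Finset.mem_univ i), smul_add,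
    smul_smul, hsgn, one_smul, hz, genOrZero_val, sub_add_cancel_left]
  exact neg_mem (Submodule.smul_mem _ _ (Submodule.sum_mem _ fun b hb =>
    Submodule.smul_mem _ _ (h b (Finset.ne_of_mem_erase hb))))

/-- Uniqueness is also required at `y₀` itself, which may have coefficient zero in `c`; the formula
then gives zero. -/
lemma boundary_apply_of_unique {k : ℕ} {c : RC R G (k + 1)} {y₀ : G.Gen (k + 1)} {z : G.Gen k}
    {i₀ : Fin (k + 2)} (hz : i₀.removeNth y₀.1 = z.1)
    (h : ∀ y, c y ≠ 0 ∨ y = y₀ → ∀ i : Fin (k + 2), i.removeNth y.1 = z.1 → y = y₀ ∧ i = i₀) :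
    boundary R G k c z = c y₀ * (-1 : R) ^ (i₀ : ℕ) := by
  have hsum : boundary R G k c z =
      c.sum fun y r => r * ∑ i : Fin (k + 2), (-1 : R) ^ (i : ℕ) *
        genOrZero R G (k := k) (i.removeNth y.1) z := by
    rw [boundary, Finsupp.linearCombination_apply, Finsupp.sum, Finsupp.finsetSum_apply]
    refine Finset.sum_congr rfl fun y _ => ?_
    rw [Finsupp.smul_apply, Finsupp.finsetSum_apply, smul_eq_mul]
    rfl
  rw [hsum, Finsupp.sum, Finset.sum_eq_single y₀]
  · rw [Finset.sum_eq_single i₀]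
    · rw [hz, genOrZero_val, Finsupp.single_eq_same, mul_one]
    · intro i _ hne
      rw [genOrZero_apply_of_ne fun he => hne (h y₀ (Or.inr rfl) i he).2, mul_zero]
    · simp
  · intro y hy hne
    rw [Finset.sum_eq_zero, mul_zero]
    intro i _
    rw [genOrZero_apply_of_ne fun he => hne (h y (Or.inl (Finsupp.mem_support_iff.mp hy)) i he).1,
      mul_zero]
  · intro hn
    rw [Finsupp.notMem_support_iff.mp hn, zero_mul]

lemma boundary_mem_chains {k : ℕ} {s : (Fin (k + 2) → G.V) → Prop}
    {t : (Fin (k + 1) → G.V) → Prop}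
    (h : ∀ x, G.IsGen (k := k + 1) x → s x → ∀ i : Fin (k + 2),
      G.IsGen (k := k) (i.removeNth x) → t (i.removeNth x)) {c : RC R G (k + 1)}
    (hc : c ∈ chains R G (k + 1) s) : boundary R G k c ∈ chains R G k t := by
  suffices hle : chains R G (k + 1) s ≤ (chains R G k t).comap (boundary R G k) from hle hc
  rw [chains_le_iff]
  intro x hx hs
  rw [Submodule.mem_comap, boundary_single]
  exact Submodule.sum_mem _ fun i _ =>
    Submodule.smul_mem _ _ (genOrZero_mem_chains fun hg => h x hx hs i hg)

lemma chainMap_mem_chains (f : G ⟶ H) {k : ℕ} {s : (Fin (k + 1) → G.V) → Prop}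
    {t : (Fin (k + 1) → H.V) → Prop}
    (h : ∀ x, G.IsGen x → s x → H.IsGen (f.toFun ∘ x) → t (f.toFun ∘ x)) {c : RC R G k}
    (hc : c ∈ chains R G k s) : chainMap R f k c ∈ chains R H k t := by
  suffices hle : chains R G k s ≤ (chains R H k t).comap (chainMap R f k) from hle hc
  rw [chains_le_iff]
  intro x hx hs
  rw [Submodule.mem_comap, ← genOrZero_of_isGen R hx, chainMap_genOrZero R f hx.isReach]
  exact genOrZero_mem_chains fun hg => h x hx hs hg

lemma lengthFiltration_eq (p : ℤ) (k : ℕ) :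
    lengthFiltration R G p k = chains R G k (fun x => (G.nlength x : ℤ) ≤ p) := by
  refine le_antisymm (Submodule.span_le.mpr ?_) (chains_le_iff.mpr fun x hx hp => ?_)
  · rintro _ ⟨x, ⟨m, hm, hp⟩, rfl⟩
    rw [x.2.isReach.length_eq] at hm
    refine Finsupp.single_mem_supported R 1 ?_
    have : G.nlength x.1 = m := by exact_mod_cast hm
    simpa [this] using hp
  · exact Submodule.subset_span ⟨⟨x, hx⟩, ⟨_, hx.isReach.length_eq, hp⟩, rfl⟩

end supported

/-! ### Acyclicity of the detours -/

section acyclic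

variable {R : Type v} [CommRing R] {G : DiGraph.{u}} {S : Set G.V}

/-- The tuples leaving `S` by a projection, with at least two entries in `S` and exactly `N` entries
outside `S`. -/
def ReturnAt (G : DiGraph.{u}) (S : Set G.V) (N : ℕ) {k : ℕ} (x : Fin (k + 1) → G.V) (c : Fin k) :
    Prop :=
  Cross S x c ∧ 0 < (c : ℕ) ∧ G.IsProj S (x c.castSucc) (x c.succ) ∧ k = c + N

/-- A detour with at most `N` entries outside `S`. -/
def DetourLE (G : DiGraph.{u}) (S : Set G.V) (N : ℕ) {k : ℕ} (x : Fin (k + 1) → G.V) : Prop :=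
  ∃ c : Fin k, G.DetourAt S x c ∧ k ≤ c + N

/-- The detours whose entries outside `S` are at most `N`, up to shorter tuples. -/
def LowDetour (G : DiGraph.{u}) (S : Set G.V) (N : ℕ) (l : ℤ) {k : ℕ} (x : Fin (k + 1) → G.V) :
    Prop :=
  (G.nlength x : ℤ) ≤ l ∧ (G.DetourLE S N x ∨ (G.nlength x : ℤ) ≤ l - 1)

lemma nlength_eq_or_le {k : ℕ} {x : Fin (k + 2) → G.V} (hx : G.IsGen (k := k + 1) x) {l : ℤ}
    (hl : (G.nlength (k := k + 1) x : ℤ) ≤ l) (i : Fin (k + 2)) :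
    G.nlength (k := k) (i.removeNth x) = G.nlength (k := k + 1) x ∨
      (G.nlength (k := k) (i.removeNth x) : ℤ) ≤ l - 1 := by
  have := hx.isReach.nlength_removeNth_le i
  omega

variable (hS : G.IsProjective S)

include hS

lemma IsProjective.lowDetour_removeNth {N : ℕ} {l : ℤ} {k : ℕ} {x : Fin (k + 2) → G.V}
    (hx : G.IsGen (k := k + 1) x) (h : G.LowDetour S N l (k := k + 1) x) (i : Fin (k + 2)) :
    G.LowDetour S N l (k := k) (i.removeNth x) := by
  have h0 := hx.isReach.nlength_removeNth_le i
  obtain ⟨hl, h⟩ := h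
  refine ⟨by omega, ?_⟩
  rcases h with ⟨c, hc, hk⟩ | h
  · rcases nlength_eq_or_le hx hl i with h1 | h1
    · obtain ⟨e, he, hce⟩ := hS.detourAt_removeNth hx hc h1
      exact Or.inl ⟨e, he, by omega⟩
    · exact Or.inr h1
  · exact Or.inr (by omega)

/-- The faces of a returning tuple other than the one omitting its last entry in `S`. -/
lemma IsProjective.returnAt_removeNth {N : ℕ} {l : ℤ} {k : ℕ} {x : Fin (k + 2) → G.V}
    (hx : G.IsGen (k := k + 1) x) {c : Fin k} (h : G.ReturnAt S (N + 1) (k := k + 1) x c.succ)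
    (hl : (G.nlength (k := k + 1) x : ℤ) = l) {i : Fin (k + 2)} (hi : i ≠ c.succ.castSucc) :
    (G.ReturnAt S (N + 1) (k := k) (i.removeNth x) c ∧
      (G.nlength (k := k) (i.removeNth x) : ℤ) = l) ∨
      G.LowDetour S N l (k := k) (i.removeNth x) := by
  obtain ⟨hc, -, hp, hk⟩ := h
  have h0 := hx.isReach.nlength_removeNth_le i
  rcases nlength_eq_or_le hx hl.le i with h1 | h1
  swap
  · exact Or.inr ⟨by omega, Or.inr h1⟩
  obtain ⟨e, rfl, -⟩ := hx.interior_of_nlength_eq h1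
  have hne : (e : ℕ) ≠ c := fun h => hi (by rw [Fin.ext h])
  simp only [Fin.val_succ] at hk
  -- Omitting an earlier entry of `S` leaves a returning tuple. Omitting an entry outside `S` leaves
  -- at least two entries in `S` and only `N` outside.
  rcases lt_or_gt_of_ne hne with hlt | hgt
  · obtain ⟨h2, h3, h4⟩ := cross_removeNth_of_lt hc (i := e.succ.castSucc) (by simp; omega)
    exact Or.inl ⟨⟨h2, by omega, by rwa [h3, h4], by omega⟩, by omega⟩
  · obtain ⟨c', hc'⟩ : ∃ c' : Fin k, c.succ = c'.castSucc := ⟨⟨c + 1, by omega⟩, rfl⟩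
    have hcv : (c : ℕ) + 1 = c' := congrArg Fin.val hc'
    rw [hc'] at hc
    obtain ⟨h2, -⟩ := hS.cross_removeNth_of_gt hx.isReach hc (i := e.succ.castSucc)
      (by simp; omega)
    exact Or.inr ⟨by omega, Or.inl ⟨c', ⟨h2, Or.inl (by omega)⟩, by omega⟩⟩

/-- The face of a returning tuple omitting its last entry in `S`. -/
lemma IsProjective.isGen_removeNth {N : ℕ} {k : ℕ} {x : Fin (k + 2) → G.V}
    (hx : G.IsGen (k := k + 1) x) {c : Fin k} (h : G.ReturnAt S N (k := k + 1) x c.succ) :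
    G.IsGen (k := k) (c.succ.castSucc.removeNth x) ∧
      Cross S (k := k) (c.succ.castSucc.removeNth x) c ∧
      G.nlength (k := k) (c.succ.castSucc.removeNth x) = G.nlength (k := k + 1) x := by
  obtain ⟨hc, -, hp, -⟩ := h
  obtain ⟨h1, h2⟩ := removeNth_succ_castSucc x c
  have hr : G.Reach (x c.castSucc.castSucc) (x c.succ.castSucc) := (hx c.castSucc).2
  have hmem : x c.castSucc.castSucc ∈ S := hS.mem_of_reach hc.1 hr
  have hcross : Cross S (k := k) (c.succ.castSucc.removeNth x) c := by
    rw [Cross, h1, h2]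
    exact ⟨hmem, hc.2⟩
  refine ⟨?_, hcross, ?_⟩
  · by_contra hg
    obtain ⟨a, ha⟩ := exists_eq_of_not_isGen (hx.isReach.removeNth _) hg
    rcases lt_trichotomy a c with hlt | rfl | hgt
    · rw [Fin.removeNth_apply, Fin.removeNth_apply,
        Fin.succAbove_of_castSucc_lt _ _ (by
          simp only [Fin.lt_def, Fin.val_castSucc, Fin.val_succ] at hlt ⊢; omega),
        Fin.succAbove_of_castSucc_lt _ _ (by
          simp only [Fin.lt_def, Fin.val_castSucc, Fin.val_succ] at hlt ⊢; omega)] at ha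
      exact (hx a.castSucc).1 ha
    · exact hcross.2 (ha ▸ hcross.1)
    · rw [Fin.removeNth_apply, Fin.removeNth_apply,
        Fin.succAbove_of_le_castSucc _ _ (by
          simp only [Fin.lt_def, Fin.le_def, Fin.val_castSucc, Fin.val_succ] at hgt ⊢; omega),
        Fin.succAbove_of_le_castSucc _ _ (by
          simp only [Fin.lt_def, Fin.le_def, Fin.val_castSucc, Fin.val_succ] at hgt ⊢; omega)] at ha
      exact (hx a.succ).1 ha
  -- The omitted entry is the projection of its successor, so it lies on a shortest path from its
  -- predecessor.
  · have h3 := nlength_removeNth_interior x c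
    have h4 := hp.ndist_eq _ hmem (hr.trans hp.reach)
    omega

/-- Every detour not leaving by a projection is a face of a returning tuple. -/
lemma IsProjective.exists_returnAt {N : ℕ} {k : ℕ} {x : Fin (k + 1) → G.V}
    (hx : G.IsGen x) {c : Fin k} (h : Cross S x c) (hc : ¬ G.IsProj S (x c.castSucc) (x c.succ))
    (hk : k = c + N) :
    ∃ y : Fin (k + 2) → G.V, G.IsGen (k := k + 1) y ∧
      G.ReturnAt S N (k := k + 1) y c.succ ∧ c.succ.castSucc.removeNth y = x := by
  obtain ⟨p, hp⟩ := hS.exists_isProj h.1 (hx c).2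
  -- Insert `p` at the crossing. It differs from its predecessor, which is not a projection by `hc`,
  -- and from its successor, which is outside `S`.
  have hrp := hp.reach_of_reach _ h.1 (hx c).2
  let i : Fin (k + 2) := c.succ.castSucc
  let y : Fin (k + 2) → G.V := i.insertNth p x
  have hyi : y c.succ.castSucc = p := Fin.insertNth_apply_same (α := fun _ => G.V) i p x
  have hrem : i.removeNth y = x := funext fun a => by simp [y, Fin.removeNth]
  have hlt : ∀ a : Fin (k + 1), (a : ℕ) ≤ c → y a.castSucc = x a := fun a ha => by
    rw [← congrFun hrem a, Fin.removeNth_apply, Fin.succAbove_of_castSucc_lt _ _ (by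
      simp only [i, Fin.lt_def, Fin.val_castSucc, Fin.val_succ]; omega)]
  have hge : ∀ a : Fin (k + 1), (c : ℕ) < a → y a.succ = x a := fun a ha => by
    rw [← congrFun hrem a, Fin.removeNth_apply, Fin.succAbove_of_le_castSucc _ _ (by
      simp only [i, Fin.le_def, Fin.val_castSucc, Fin.val_succ]; omega)]
  have hy2 : y c.succ.succ = x c.succ := hge c.succ (by simp)
  refine ⟨y, fun b => ?_, ⟨⟨by rw [hyi]; exact hp.mem, by rw [hy2]; exact h.2⟩, by simp,
    by rwa [hyi, hy2], by simp only [Fin.val_succ]; omega⟩, hrem⟩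
  rcases lt_trichotomy (b : ℕ) (c + 1) with hb | hb | hb
  · obtain ⟨b, rfl⟩ : ∃ b' : Fin k, b = b'.castSucc := ⟨⟨b, by omega⟩, rfl⟩
    simp only [Fin.val_castSucc] at hb
    rw [hlt b.castSucc (by simp; omega)]
    rcases (Nat.lt_succ_iff.mp hb).lt_or_eq with hb' | hb'
    · have : y b.castSucc.succ = x b.succ := hlt b.succ (by simpa using hb')
      rw [this]
      exact hx b
    · obtain rfl : b = c := Fin.ext hb'
      have : y b.castSucc.succ = p := hyi
      rw [this]
      exact ⟨fun he => hc (he ▸ hp), hrp⟩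
  · obtain rfl : b = c.succ := Fin.ext (by simpa using hb)
    rw [hyi, hy2]
    exact ⟨fun he => h.2 (he ▸ hp.mem), hp.reach⟩
  · obtain ⟨b, rfl⟩ : ∃ b' : Fin k, b = b'.succ := ⟨⟨b - 1, by omega⟩, Fin.ext (by simp; omega)⟩
    simp only [Fin.val_succ] at hb
    have : y b.succ.castSucc = x b.castSucc := hge b.castSucc (by simp; omega)
    rw [this, hge b.succ (by simp; omega)]
    exact hx b

omit hS in
variable (G S) in
/-- The returning tuples of length `l` with `N` entries outside `S`. -/
def Return (N : ℕ) (l : ℤ) {k : ℕ} (x : Fin (k + 1) → G.V) : Prop :=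
  (G.nlength x : ℤ) = l ∧ ∃ c, G.ReturnAt S N x c

omit hS in
lemma Return.exists_succ {N : ℕ} {l : ℤ} {k : ℕ} {x : Fin (k + 2) → G.V}
    (h : G.Return S N l (k := k + 1) x) : ∃ c : Fin k, G.ReturnAt S N (k := k + 1) x c.succ := by
  obtain ⟨-, c, hc⟩ := h
  obtain ⟨c, rfl⟩ := Fin.exists_succ_eq.mpr fun h0 => hc.2.1.ne' (congrArg Fin.val h0)
  exact ⟨c, hc⟩

/-- A detour of length `l` with `N + 1` entries outside `S` that does not leave by a projection is a
face of a returning tuple. Modulo the boundary of that tuple it becomes a combination of the other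
faces, which are returning or low. -/
lemma IsProjective.chains_detourLE_le (N : ℕ) (l : ℤ) (k : ℕ) :
    chains R G k (G.LowDetour S (N + 1) l) ≤
      (chains R G (k + 1) (fun x => G.Detour S x ∧ (G.nlength x : ℤ) ≤ l)).map (boundary R G k) ⊔
        chains R G k (fun x => G.Return S (N + 1) l x ∨ G.LowDetour S N l x) := by
  rw [chains_le_iff]
  rintro x hx ⟨hl, h⟩
  have hright : G.Return S (N + 1) l x ∨ G.LowDetour S N l x →
      Finsupp.single ⟨x, hx⟩ 1 ∈ chains R G k
        (fun x => G.Return S (N + 1) l x ∨ G.LowDetour S N l x) :=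
    fun h => Finsupp.single_mem_supported R 1 h
  by_cases hl' : (G.nlength x : ℤ) ≤ l - 1
  · exact Submodule.mem_sup_right (hright (Or.inr ⟨hl, Or.inr hl'⟩))
  obtain ⟨c, ⟨hc, hc'⟩, hk⟩ := h.resolve_right hl'
  by_cases hk' : k ≤ c + N
  · exact Submodule.mem_sup_right (hright (Or.inr ⟨hl, Or.inl ⟨c, ⟨hc, hc'⟩, hk'⟩⟩))
  have hk'' : k = c + (N + 1) := by omega
  by_cases hp : G.IsProj S (x c.castSucc) (x c.succ)
  · exact Submodule.mem_sup_right (hright (Or.inl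
      ⟨by omega, c, hc, hc'.resolve_right (not_not_intro hp), hp, hk''⟩))
  obtain ⟨y, hy, hret, rfl⟩ := hS.exists_returnAt hx hc hp hk''
  have hyl : (G.nlength (k := k + 1) y : ℤ) = l := by
    have := (hS.isGen_removeNth hy hret).2.2
    omega
  have h1 : (-1 : R) ^ (c.succ.castSucc : ℕ) • Finsupp.single (⟨y, hy⟩ : G.Gen (k + 1)) (1 : R) ∈
      chains R G (k + 1) (fun x => G.Detour S x ∧ (G.nlength x : ℤ) ≤ l) :=
    Submodule.smul_mem _ _ (Finsupp.single_mem_supported R 1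
      ⟨⟨c.succ, hret.1, Or.inl (Nat.succ_pos _)⟩, hyl.le⟩)
  have h2 := single_sub_boundary_mem (R := R) (y := ⟨y, hy⟩) (i := c.succ.castSucc)
    (z := ⟨_, hx⟩) rfl (M := chains R G k
      (fun x => G.Return S (N + 1) l x ∨ G.LowDetour S N l x)) fun b hb =>
        genOrZero_mem_chains fun _ =>
          (hS.returnAt_removeNth hy hret hyl hb).imp (fun h1 => ⟨h1.2, _, h1.1⟩) id
  have h3 := Submodule.add_mem_sup (Submodule.mem_map_of_mem (f := boundary R G k) h1) h2
  rwa [add_sub_cancel] at h3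

/-- The face omitting the last entry in `S` determines its returning tuple, the omitted entry being
a projection, and is no face of any other returning tuple. So its coefficient in the boundary is, up
to sign, that of the tuple. -/
lemma IsProjective.return_chains_eq_zero {N : ℕ} {l : ℤ} {k : ℕ} {c : RC R G (k + 1)}
    (hc : c ∈ chains R G (k + 1) (G.Return S (N + 1) l))
    (hd : boundary R G k c ∈ chains R G k (G.LowDetour S N l)) : c = 0 := by
  ext ⟨y₀, hy₀⟩
  by_cases hret₀ : G.Return S (N + 1) l (k := k + 1) y₀
  swap
  · exact (Finsupp.mem_supported' R c).mp hc ⟨y₀, hy₀⟩ hret₀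
  obtain ⟨c₀, hc₀⟩ := hret₀.exists_succ
  obtain ⟨hg, hcross, hlen⟩ := hS.isGen_removeNth hy₀ hc₀
  obtain ⟨hv1, hv2⟩ := removeNth_succ_castSucc y₀ c₀
  have hl₀ := hret₀.1
  have hk₀ := hc₀.2.2.2
  simp only [Fin.val_succ] at hk₀
  -- This face has full length and exactly `N + 1` entries outside `S`.
  have hlow : ¬ G.LowDetour S N l (k := k) (c₀.succ.castSucc.removeNth y₀) := by
    rintro ⟨-, ⟨e, he, hk⟩ | h⟩
    · obtain rfl := hS.cross_unique hg.isReach he.1 hcross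
      omega
    · omega
  have hface : ∀ y (hy : G.IsGen (k := k + 1) y), G.Return S (N + 1) l (k := k + 1) y →
      ∀ i : Fin (k + 2), i.removeNth y = c₀.succ.castSucc.removeNth y₀ →
        y = y₀ ∧ i = c₀.succ.castSucc := by
    intro y hy hret i hi
    obtain ⟨c₁, hc₁⟩ := hret.exists_succ
    by_cases hne : i = c₁.succ.castSucc
    · subst hne
      obtain ⟨-, hcross', -⟩ := hS.isGen_removeNth hy hc₁
      obtain ⟨-, hw2⟩ := removeNth_succ_castSucc y c₁
      rw [hi] at hcross' hw2
      obtain rfl := hS.cross_unique hg.isReach hcross' hcross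
      have hp : y c₁.succ.castSucc = y₀ c₁.succ.castSucc :=
        hc₁.2.2.1.unique (by rw [← hw2, hv2]; exact hc₀.2.2.1)
      refine ⟨?_, rfl⟩
      rw [← Fin.insertNth_self_removeNth c₁.succ.castSucc y, hi, hp, Fin.insertNth_self_removeNth]
    · rcases hS.returnAt_removeNth hy hc₁ hret.1 hne with ⟨⟨h1, -, h2, -⟩, -⟩ | h1
      · rw [hi] at h1 h2
        obtain rfl := hS.cross_unique hg.isReach h1 hcross
        rw [hv1, hv2] at h2
        exact absurd (h2.unique hc₀.2.2.1) (hy₀ c₁.castSucc).1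
      · rw [hi] at h1
        exact absurd h1 hlow
  have hzero := (Finsupp.mem_supported' R _).mp hd ⟨_, hg⟩ hlow
  have hcoef := boundary_apply_of_unique (c := c) (y₀ := ⟨y₀, hy₀⟩) (z := ⟨_, hg⟩) rfl
    fun y hy i hi => by
      have hret : G.Return S (N + 1) l (k := k + 1) y.1 := by
        rcases hy with hy | rfl
        · exact hc (Finsupp.mem_support_iff.mpr hy)
        · exact hret₀
      exact (hface y.1 y.2 hret i hi).imp_left Subtype.ext
  rw [hcoef] at hzero
  exact (isUnit_one.neg.pow _).mul_left_eq_zero.mp hzero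

/-- Induction on the number of entries outside `S`: modulo a boundary, the chain is `r + e` with `r`
returning and `e` low. The boundaries of `r + e` and of `e` are low, hence that of `r` is, which
forces `r = 0`. -/
lemma IsProjective.exists_boundary_of_lowDetour (N : ℕ) {l : ℤ} {k : ℕ} {c : RC R G (k + 1)}
    (hc : c ∈ chains R G (k + 1) (G.LowDetour S N l))
    (hd : boundary R G k c ∈ chains R G k (fun x => (G.nlength x : ℤ) ≤ l - 1)) :
    ∃ b ∈ chains R G (k + 2) (fun x => G.Detour S x ∧ (G.nlength x : ℤ) ≤ l),
      c - boundary R G (k + 1) b ∈ chains R G (k + 1) (fun x => (G.nlength x : ℤ) ≤ l - 1) := by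
  induction N generalizing c with
  | zero =>
    refine ⟨0, zero_mem _, ?_⟩
    rw [map_zero, sub_zero]
    -- A crossing leaves at least one entry outside `S`, so for `N = 0` only shorter tuples occur.
    refine chains_mono (fun x _ hx => ?_) hc
    rcases hx.2 with ⟨e, -, he⟩ | h
    · omega
    · exact h
  | succ N ih =>
    obtain ⟨_, ⟨b, hb, rfl⟩, a, ha, rfl⟩ :=
      Submodule.mem_sup.mp (hS.chains_detourLE_le N l (k + 1) hc)
    obtain ⟨r, hr, e, he, rfl⟩ := mem_chains_or.mp ha
    have hbb : ∀ b, boundary R G k (boundary R G (k + 1) b) = 0 := fun b =>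
      LinearMap.congr_fun (boundary_boundary R G k) b
    rw [map_add, map_add, hbb, zero_add] at hd
    have hde : boundary R G k e ∈ chains R G k (G.LowDetour S N l) :=
      boundary_mem_chains (fun x hx hs i _ => hS.lowDetour_removeNth hx hs i) he
    obtain rfl : r = 0 := by
      refine hS.return_chains_eq_zero hr ?_
      have := sub_mem (chains_mono (fun x _ hx => ⟨by omega, Or.inr hx⟩) hd) hde
      rwa [add_sub_cancel_right] at this
    rw [map_zero, zero_add] at hd
    obtain ⟨b', hb', hbe⟩ := ih he hd
    refine ⟨b + b', add_mem hb hb', ?_⟩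
    rwa [map_add, zero_add, add_sub_add_left_eq_sub]

/-- The detours span an acyclic complex on the first page. -/
theorem IsProjective.exists_boundary_of_detour {l : ℤ} {k : ℕ} {c : RC R G (k + 1)}
    (hc : c ∈ chains R G (k + 1) (fun x => G.Detour S x ∧ (G.nlength x : ℤ) ≤ l))
    (hd : boundary R G k c ∈ chains R G k (fun x => (G.nlength x : ℤ) ≤ l - 1)) :
    ∃ b ∈ chains R G (k + 2) (fun x => G.Detour S x ∧ (G.nlength x : ℤ) ≤ l),
      c - boundary R G (k + 1) b ∈ chains R G (k + 1) (fun x => (G.nlength x : ℤ) ≤ l - 1) :=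
  hS.exists_boundary_of_lowDetour (k + 1) (chains_mono
    (fun _ _ ⟨⟨e, he⟩, hl⟩ => ⟨hl, Or.inl ⟨e, he, by omega⟩⟩) hc) hd

end acyclic

end DiGraph

namespace DiGraph

/-! ### Direct tuples and their transport along the comparison map -/

section direct

variable {G : DiGraph.{u}} {S : Set G.V}

/-- The tuples not contained in `S` that are not detours. -/
def Direct (G : DiGraph.{u}) (S : Set G.V) {k : ℕ} (x : Fin (k + 1) → G.V) : Prop :=
  x (Fin.last k) ∉ S ∧ ¬ G.Detour S x

lemma exists_cross {k : ℕ} {x : Fin (k + 1) → G.V} (hl : x (Fin.last k) ∉ S) {a : Fin (k + 1)}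
    (ha : x a ∈ S) : ∃ c : Fin k, a ≤ c.castSucc ∧ Cross S x c := by
  by_contra! h
  have : ∀ b, a ≤ b → x b ∈ S := by
    intro b
    induction b using Fin.induction with
    | zero =>
      intro hab
      obtain rfl : a = 0 := Fin.le_zero_iff.mp hab
      exact ha
    | succ b ih =>
      intro hab
      rcases hab.eq_or_lt with rfl | hlt
      · exact ha
      · have hb := Fin.le_castSucc_iff.mpr hlt
        by_contra hn
        exact h b hb ⟨ih hb, hn⟩
  exact hl (this _ (Fin.le_last a))

lemma Direct.succ_notMem {k : ℕ} {x : Fin (k + 1) → G.V} (h : G.Direct S x) (c : Fin k) :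
    x c.succ ∉ S := by
  intro hc
  obtain ⟨e, he, hx⟩ := exists_cross h.1 hc
  refine h.2 ⟨e, hx, Or.inl ?_⟩
  have := Fin.le_def.mp he
  simp only [Fin.val_succ, Fin.val_castSucc] at this
  omega

lemma Direct.isProj {k : ℕ} {x : Fin (k + 1) → G.V} (h : G.Direct S x) {c : Fin k}
    (hc : x c.castSucc ∈ S) : G.IsProj S (x c.castSucc) (x c.succ) := by
  by_contra hn
  exact h.2 ⟨c, ⟨hc, h.succ_notMem c⟩, Or.inr hn⟩

/-- Only the first entry can lie in `S`. The condition is local at each step, which is what allows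
it to be checked after applying `g`. -/
lemma direct_iff {k : ℕ} {x : Fin (k + 1) → G.V} : G.Direct S x ↔ x (Fin.last k) ∉ S ∧
    ∀ c : Fin k, x c.succ ∉ S ∧ (x c.castSucc ∈ S → G.IsProj S (x c.castSucc) (x c.succ)) := by
  refine ⟨fun h => ⟨h.1, fun c => ⟨h.succ_notMem c, h.isProj⟩⟩, fun h => ⟨h.1, ?_⟩⟩
  rintro ⟨c, hc, hpos | hn⟩
  · obtain ⟨k, rfl⟩ : ∃ m, k = m + 1 := ⟨k - 1, by omega⟩
    obtain ⟨e, rfl⟩ := Fin.exists_succ_eq.mpr fun h0 => hpos.ne' (congrArg Fin.val h0)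
    exact (h.2 e.castSucc).1 hc.1
  · exact hn ((h.2 c).2 hc.1)

end direct

/-- The properties of the comparison map `X → X ∪_A Y` relative to the vertices of `A` and `Y`
that make excision work. -/
structure IsExcision {X P : DiGraph.{u}} (g : X ⟶ P) (S : Set X.V) (T : Set P.V) : Prop where
  mem_iff : ∀ x, g.toFun x ∈ T ↔ x ∈ S
  injOn : ∀ {x x'}, x ∉ S → x' ∉ S → g.toFun x = g.toFun x' → x = x'
  surjOn : ∀ v, v ∉ T → ∃ x, x ∉ S ∧ g.toFun x = v
  reach : ∀ {x x'}, x ∉ S → x' ∉ S → P.Reach (g.toFun x) (g.toFun x') → X.Reach x x'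
  ndist_eq : ∀ {x x'}, x ∉ S → x' ∉ S → X.Reach x x' →
    P.ndist (g.toFun x) (g.toFun x') = X.ndist x x'
  isProj : ∀ {p x}, x ∉ S → X.IsProj S p x → P.IsProj T (g.toFun p) (g.toFun x)
  ndist_proj : ∀ {p x}, x ∉ S → X.IsProj S p x → P.ndist (g.toFun p) (g.toFun x) = X.ndist p x
  exists_isProj : ∀ {s x}, x ∉ S → s ∈ T → P.Reach s (g.toFun x) → ∃ p, X.IsProj S p x

namespace IsExcision

variable {X P : DiGraph.{u}} {g : X ⟶ P} {S : Set X.V} {T : Set P.V} (hg : IsExcision g S T)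

include hg

lemma map_direct {k : ℕ} {x : Fin (k + 1) → X.V} (hx : X.IsGen x) (h : X.Direct S x) :
    P.IsGen (g.toFun ∘ x) ∧ P.Direct T (g.toFun ∘ x) ∧
      P.nlength (g.toFun ∘ x) = X.nlength x := by
  refine ⟨fun c => ⟨fun he => ?_, (hx c).2.map g⟩, direct_iff.mpr ⟨?_, fun c => ⟨?_, fun hc => ?_⟩⟩,
    Finset.sum_congr rfl fun c _ => ?_⟩
  · by_cases hc : x c.castSucc ∈ S
    · exact h.succ_notMem c ((hg.mem_iff _).mp (Eq.subst (motive := (· ∈ T)) he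
        ((hg.mem_iff _).mpr hc)))
    · exact (hx c).1 (hg.injOn hc (h.succ_notMem c) he)
  · exact fun hl => h.1 ((hg.mem_iff _).mp hl)
  · exact fun hl => h.succ_notMem c ((hg.mem_iff _).mp hl)
  · exact hg.isProj (h.succ_notMem c) (h.isProj ((hg.mem_iff _).mp hc))
  · by_cases hc : x c.castSucc ∈ S
    · exact hg.ndist_proj (h.succ_notMem c) (h.isProj hc)
    · exact hg.ndist_eq hc (h.succ_notMem c) (hx c).2

/-- `g` need not be injective on `S`, but an entry in `S` is recovered as the projection of its
successor. -/
lemma direct_injective {k : ℕ} {x x' : Fin (k + 1) → X.V} (h : X.Direct S x) (h' : X.Direct S x')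
    (he : g.toFun ∘ x = g.toFun ∘ x') : x = x' := by
  have hout : ∀ a, x a ∉ S → x a = x' a := fun a ha => by
    have h1 : g.toFun (x a) = g.toFun (x' a) := congrFun he a
    exact hg.injOn ha (fun h2 => ha ((hg.mem_iff _).mp (h1 ▸ (hg.mem_iff _).mpr h2))) h1
  funext a
  by_cases ha : x a ∈ S
  · obtain ⟨c, rfl⟩ : ∃ c : Fin k, c.castSucc = a :=
      Fin.exists_castSucc_eq.mpr fun hl => h.1 (hl ▸ ha)
    have h1 : g.toFun (x c.castSucc) = g.toFun (x' c.castSucc) := congrFun he _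
    have h2 := h'.isProj ((hg.mem_iff _).mp (h1 ▸ (hg.mem_iff _).mpr ha))
    rw [← hout c.succ (h.succ_notMem c)] at h2
    exact (h.isProj ha).unique h2
  · exact hout a ha

lemma exists_direct {k : ℕ} {z : Fin (k + 1) → P.V} (hz : P.IsGen z) (h : P.Direct T z) :
    ∃ x, X.IsGen x ∧ X.Direct S x ∧ g.toFun ∘ x = z := by
  -- Entries are lifted one at a time. Lifts outside `T` are unique; an entry in `T` is lifted to
  -- the projection of the lift of its successor.
  have key : ∀ a, ∃ v, g.toFun v = z a ∧ ∀ c : Fin k, c.castSucc = a → z a ∈ T →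
      ∃ w, w ∉ S ∧ g.toFun w = z c.succ ∧ X.IsProj S v w := by
    intro a
    by_cases ha : z a ∈ T
    · obtain ⟨c, rfl⟩ : ∃ c : Fin k, c.castSucc = a :=
        Fin.exists_castSucc_eq.mpr fun hl => h.1 (hl ▸ ha)
      obtain ⟨w, hw, hwz⟩ := hg.surjOn _ (h.succ_notMem c)
      obtain ⟨p, hp⟩ := hg.exists_isProj hw ha (hwz ▸ (hz c).2)
      refine ⟨p, (hg.isProj hw hp).unique (hwz ▸ h.isProj ha), fun c' hc' _ => ?_⟩
      obtain rfl : c' = c := Fin.castSucc_injective k hc'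
      exact ⟨w, hw, hwz, hp⟩
    · obtain ⟨v, -, hv⟩ := hg.surjOn _ ha
      exact ⟨v, hv, fun _ _ h' => absurd h' ha⟩
  choose x hxz hx using key
  have hout : ∀ a, z a ∉ T → x a ∉ S := fun a ha hm => ha (hxz a ▸ (hg.mem_iff _).mpr hm)
  have hproj : ∀ c : Fin k, z c.castSucc ∈ T → X.IsProj S (x c.castSucc) (x c.succ) := by
    intro c hc
    obtain ⟨w, hw, hwz, hp⟩ := hx c.castSucc c rfl hc
    rwa [hg.injOn (hout c.succ (h.succ_notMem c)) hw ((hxz _).trans hwz.symm)]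
  refine ⟨x, fun c => ⟨fun he => (hz c).1 ?_, ?_⟩, direct_iff.mpr ⟨hout _ h.1, fun c =>
    ⟨hout _ (h.succ_notMem c), fun hc => hproj c (hxz c.castSucc ▸ (hg.mem_iff _).mpr hc)⟩⟩,
    funext hxz⟩
  · rw [← hxz, ← hxz, he]
  · by_cases hc : z c.castSucc ∈ T
    · exact (hproj c hc).reach
    · exact hg.reach (hout _ hc) (hout _ (h.succ_notMem c)) (by rw [hxz, hxz]; exact (hz c).2)

/-- A single entry `s` in `S` may be sent by `g` to the image of the projection `p` of its
successor. The detour then becomes direct, but it loses the positive length `d(s, p)`. -/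
lemma map_detour (hS : X.IsProjective S) {k : ℕ} {x : Fin (k + 1) → X.V} (hx : X.IsGen x)
    (h : X.Detour S x) : P.Detour T (g.toFun ∘ x) ∨ P.nlength (g.toFun ∘ x) < X.nlength x := by
  obtain ⟨c, ⟨hc1, hc2⟩, hc⟩ := h
  have hcross : Cross T (g.toFun ∘ x) c :=
    ⟨(hg.mem_iff _).mpr hc1, fun hm => hc2 ((hg.mem_iff _).mp hm)⟩
  rcases hc with hpos | hn
  · exact Or.inl ⟨c, hcross, Or.inl hpos⟩
  by_cases hp : P.IsProj T (g.toFun (x c.castSucc)) (g.toFun (x c.succ))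
  · refine Or.inr (Finset.sum_lt_sum (fun b _ => ndist_map_le g (hx b).2) ⟨c, Finset.mem_univ _, ?_⟩)
    obtain ⟨p, hpx⟩ := hS.exists_isProj hc1 (hx c).2
    have h1 : g.toFun (x c.castSucc) = g.toFun p := hp.unique (hg.isProj hc2 hpx)
    have h2 := hpx.ndist_eq _ hc1 (hx c).2
    have h3 : 0 < X.ndist (x c.castSucc) p := Nat.pos_of_ne_zero fun h0 =>
      hn ((hpx.reach_of_reach _ hc1 (hx c).2).eq_of_ndist_eq_zero h0 ▸ hpx)
    have h4 := hg.ndist_proj hc2 hpx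
    simp only [Function.comp_apply]
    rw [h1, h4]
    omega
  · exact Or.inl ⟨c, hcross, Or.inr hp⟩

end IsExcision

/-- An isometric embedding of directed graphs. -/
structure IsEmbedding {A X : DiGraph.{u}} (i : A ⟶ X) : Prop where
  injective : Function.Injective i.toFun
  reach : ∀ {a b}, X.Reach (i.toFun a) (i.toFun b) → A.Reach a b
  ndist_eq : ∀ {a b}, A.Reach a b → X.ndist (i.toFun a) (i.toFun b) = A.ndist a b

namespace IsEmbedding

variable {A X : DiGraph.{u}} {i : A ⟶ X} (hi : IsEmbedding i)

include hi

lemma isGen_iff {k : ℕ} {x : Fin (k + 1) → A.V} : X.IsGen (i.toFun ∘ x) ↔ A.IsGen x :=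
  ⟨fun h c => ⟨fun he => (h c).1 (congrArg i.toFun he), hi.reach (h c).2⟩,
    fun h c => ⟨fun he => (h c).1 (hi.injective he), (h c).2.map i⟩⟩

lemma nlength_eq {k : ℕ} {x : Fin (k + 1) → A.V} (hx : A.IsGen x) :
    X.nlength (i.toFun ∘ x) = A.nlength x :=
  Finset.sum_congr rfl fun c _ => hi.ndist_eq (hx c).2

end IsEmbedding

/-! ### Lifting chains along embeddings and excisions -/

section maps

variable {R : Type v} [CommRing R] {G H : DiGraph.{u}}

lemma chainMap_single (f : G ⟶ H) {k : ℕ} (x : G.Gen k) :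
    chainMap R f k (Finsupp.single x 1) = genOrZero R H (f.toFun ∘ x.1) := by
  simp [chainMap]

lemma chainMap_apply_of_unique (f : G ⟶ H) {k : ℕ} {c : RC R G k} {x₀ : G.Gen k} {z : H.Gen k}
    (hz : f.toFun ∘ x₀.1 = z.1) (h : ∀ x, c x ≠ 0 → f.toFun ∘ x.1 = z.1 → x = x₀) :
    chainMap R f k c z = c x₀ := by
  have hsum : chainMap R f k c z = c.sum fun x r => r * genOrZero R H (f.toFun ∘ x.1) z := by
    rw [chainMap, Finsupp.linearCombination_apply, Finsupp.sum, Finsupp.finsetSum_apply]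
    rfl
  rw [hsum, Finsupp.sum, Finset.sum_eq_single x₀]
  · rw [hz, genOrZero_val, Finsupp.single_eq_same, mul_one]
  · intro x hx hne
    rw [genOrZero_apply_of_ne fun he => hne (h x (Finsupp.mem_support_iff.mp hx) he), mul_zero]
  · intro hn
    rw [Finsupp.notMem_support_iff.mp hn, zero_mul]

lemma IsEmbedding.mem_chains {f : G ⟶ H} (hf : IsEmbedding f) {k : ℕ} {c : RC R G k} {l : ℤ}
    (h : chainMap R f k c ∈ chains R H k (fun x => (H.nlength x : ℤ) ≤ l)) :
    c ∈ chains R G k (fun x => (G.nlength x : ℤ) ≤ l) := by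
  intro x hx
  have hgen := hf.isGen_iff.mpr x.2
  have h1 : chainMap R f k c ⟨_, hgen⟩ = c x := chainMap_apply_of_unique f rfl fun y _ hy =>
    Subtype.ext (funext fun a => hf.injective (congrFun hy a))
  have h2 := of_mem_chains h (h1.trans_ne (Finsupp.mem_support_iff.mp hx))
  rwa [hf.nlength_eq x.2] at h2

lemma IsEmbedding.exists_chain {f : G ⟶ H} (hf : IsEmbedding f)
    (hr : H.IsProjective (Set.range f.toFun)) {k : ℕ} {c : RC R H k} {l : ℤ}
    (hc : c ∈ chains R H k
      (fun x => x (Fin.last k) ∈ Set.range f.toFun ∧ (H.nlength x : ℤ) ≤ l)) :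
    ∃ b ∈ chains R G k (fun x => (G.nlength x : ℤ) ≤ l), chainMap R f k b = c := by
  suffices hle : chains R H k
      (fun x => x (Fin.last k) ∈ Set.range f.toFun ∧ (H.nlength x : ℤ) ≤ l) ≤
      (chains R G k (fun x => (G.nlength x : ℤ) ≤ l)).map (chainMap R f k) from hle hc
  rw [chains_le_iff]
  rintro x hx ⟨hm, hl⟩
  choose y hy using fun a => hr.mem_of_le hx.isReach (Fin.le_last a) hm
  obtain rfl : f.toFun ∘ y = x := funext hy
  have hy' := hf.isGen_iff.mp hx
  rw [hf.nlength_eq hy'] at hl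
  refine ⟨Finsupp.single ⟨y, hy'⟩ 1, single_mem_chains hy' hl, ?_⟩
  rw [chainMap_single, genOrZero_of_isGen R hx]

variable {X P : DiGraph.{u}} {g : X ⟶ P} {S : Set X.V} {T : Set P.V}

lemma IsExcision.exists_chain (hg : IsExcision g S T) {k : ℕ} {c : RC R P k} {l : ℤ}
    (hc : c ∈ chains R P k (fun x => P.Direct T x ∧ (P.nlength x : ℤ) ≤ l)) :
    ∃ b ∈ chains R X k (fun x => X.Direct S x ∧ (X.nlength x : ℤ) ≤ l),
      chainMap R g k b = c := by
  suffices hle : chains R P k (fun x => P.Direct T x ∧ (P.nlength x : ℤ) ≤ l) ≤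
      (chains R X k (fun x => X.Direct S x ∧ (X.nlength x : ℤ) ≤ l)).map (chainMap R g k)
    from hle hc
  rw [chains_le_iff]
  rintro z hz ⟨hd, hl⟩
  obtain ⟨x, hx, hxd, rfl⟩ := hg.exists_direct hz hd
  rw [(hg.map_direct hx hxd).2.2] at hl
  refine ⟨Finsupp.single ⟨x, hx⟩ 1, single_mem_chains hx ⟨hxd, hl⟩, ?_⟩
  rw [chainMap_single, genOrZero_of_isGen R hz]

lemma IsExcision.chainMap_detour (hg : IsExcision g S T) (hS : X.IsProjective S) {k : ℕ}
    {c : RC R X k} {l : ℤ}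
    (hc : c ∈ chains R X k (fun x => X.Detour S x ∧ (X.nlength x : ℤ) ≤ l)) :
    chainMap R g k c ∈ chains R P k
      (fun x => (P.Detour T x ∧ (P.nlength x : ℤ) ≤ l) ∨ (P.nlength x : ℤ) ≤ l - 1) := by
  refine chainMap_mem_chains g (fun x hx ⟨hd, hl⟩ _ => ?_) hc
  have := hx.isReach.nlength_map_le g
  rcases hg.map_detour hS hx hd with h | h
  · exact Or.inl ⟨h, by omega⟩
  · exact Or.inr (by omega)

/-- A chain mapped to detours and shorter tuples consists of such tuples itself. -/
lemma IsExcision.mem_chains (hg : IsExcision g S T) (hS : X.IsProjective S) {k : ℕ}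
    {c : RC R X k} {l : ℤ}
    (hc : c ∈ chains R X k (fun x => (x (Fin.last k) ∉ S ∧ (X.nlength x : ℤ) ≤ l) ∨
      (X.nlength x : ℤ) ≤ l - 1))
    (h : chainMap R g k c ∈ chains R P k (fun x => P.Detour T x ∨ (P.nlength x : ℤ) ≤ l - 1)) :
    c ∈ chains R X k (fun x => (X.Detour S x ∧ (X.nlength x : ℤ) ≤ l) ∨
      (X.nlength x : ℤ) ≤ l - 1) := by
  classical
  have hsplit : c ∈ chains R X k (fun x => X.Direct S x ∨
      ((X.Detour S x ∧ (X.nlength x : ℤ) ≤ l) ∨ (X.nlength x : ℤ) ≤ l - 1)) := by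
    refine chains_mono (fun x _ hx => ?_) hc
    rcases hx with ⟨h1, h2⟩ | h1
    · by_cases hd : X.Detour S x
      · exact Or.inr (Or.inl ⟨hd, h2⟩)
      · exact Or.inl ⟨h1, hd⟩
    · exact Or.inr (Or.inr h1)
  obtain ⟨q, hq, r, hr, rfl⟩ := mem_chains_or.mp hsplit
  obtain ⟨d, hd, e, he, rfl⟩ := mem_chains_or.mp hr
  have hφd := chains_mono (R := R) (fun x _ hx => hx.imp_left And.left) (hg.chainMap_detour hS hd)
  have hφe : chainMap R g k e ∈ chains R P k
      (fun x => P.Detour T x ∨ (P.nlength x : ℤ) ≤ l - 1) := by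
    refine chainMap_mem_chains g (fun x hx hl _ => Or.inr ?_) he
    have := hx.isReach.nlength_map_le g
    omega
  rw [map_add, map_add] at h
  have hφq := sub_mem h (add_mem hφd hφe)
  rw [add_sub_cancel_right] at hφq
  -- Direct tuples map injectively to direct tuples of the same length, so the coefficients of `q`
  -- can be read off in `P`, where no direct tuple of length `l` is allowed.
  refine add_mem (fun x hx => Or.inr ?_) hr
  have hxd : X.Direct S x.1 := hq hx
  obtain ⟨h1, h2, h3⟩ := hg.map_direct x.2 hxd
  have h4 : chainMap R g k q ⟨_, h1⟩ = q x := chainMap_apply_of_unique g rfl fun y hy he =>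
    Subtype.ext (hg.direct_injective (hq (Finsupp.mem_support_iff.mpr hy)) hxd he)
  rcases of_mem_chains hφq (h4.trans_ne (Finsupp.mem_support_iff.mp hx)) with h5 | h5
  · exact absurd h5 h2.2
  · rwa [h3] at h5

end maps

end DiGraph

namespace DiGraph

/-! ### First page cycles and boundaries in terms of length -/

section graded

variable (R : Type v) [CommRing R] (G : DiGraph.{u}) {H : DiGraph.{u}}

/-- The chains of length at most `l`. -/
abbrev upTo (k : ℕ) (l : ℤ) : Submodule R (RC R G k) :=
  chains R G k fun x => (G.nlength x : ℤ) ≤ l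

/-- The chains of length at most `l` whose boundary is shorter. -/
noncomputable def gradedCycles (l : ℤ) : ∀ n, Submodule R (RC R G n)
  | 0 => upTo R G 0 l
  | n + 1 => upTo R G (n + 1) l ⊓ (upTo R G n (l - 1)).comap (boundary R G n)

/-- The boundaries of chains of length at most `l`, up to shorter chains. -/
noncomputable def gradedBoundaries (l : ℤ) (n : ℕ) : Submodule R (RC R G n) :=
  upTo R G n (l - 1) ⊔ (upTo R G (n + 1) l).map (boundary R G n)

variable {R G} {l : ℤ}

lemma boundary_mem_upTo {n : ℕ} {c : RC R G (n + 1)} (hc : c ∈ upTo R G (n + 1) l) :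
    boundary R G n c ∈ upTo R G n l :=
  boundary_mem_chains (fun x hx h i _ => by
    have := hx.isReach.nlength_removeNth_le i
    omega) hc

lemma chainMap_mem_upTo (f : G ⟶ H) {n : ℕ} {c : RC R G n} (hc : c ∈ upTo R G n l) :
    chainMap R f n c ∈ upTo R H n l :=
  chainMap_mem_chains f (fun x hx h _ => by
    have := hx.isReach.nlength_map_le f
    omega) hc

lemma boundary_boundary_apply {n : ℕ} (c : RC R G (n + 2)) :
    boundary R G n (boundary R G (n + 1) c) = 0 := LinearMap.congr_fun (boundary_boundary R G n) c

lemma boundary_chainMap_apply (f : G ⟶ H) {n : ℕ} (c : RC R G (n + 1)) :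
    boundary R H n (chainMap R f (n + 1) c) = chainMap R f n (boundary R G n c) :=
  LinearMap.congr_fun (boundary_chainMap R f n) c

lemma upTo_mono {n : ℕ} {l l' : ℤ} (h : l ≤ l') : upTo R G n l ≤ upTo R G n l' :=
  chains_mono fun _ _ hx => hx.trans h

lemma gradedCycles_le {n : ℕ} : gradedCycles R G l n ≤ upTo R G n l := by
  cases n with
  | zero => exact le_rfl
  | succ n => exact inf_le_left

lemma upTo_le_gradedCycles {n : ℕ} : upTo R G n (l - 1) ≤ gradedCycles R G l n := by
  cases n with
  | zero => exact upTo_mono (by omega)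
  | succ n => exact le_inf (upTo_mono (by omega)) fun c hc => boundary_mem_upTo hc

lemma boundary_mem_gradedCycles {n : ℕ} {c : RC R G (n + 1)} (hc : c ∈ upTo R G (n + 1) l) :
    boundary R G n c ∈ gradedCycles R G l n := by
  cases n with
  | zero => exact boundary_mem_upTo hc
  | succ n =>
    refine ⟨boundary_mem_upTo hc, ?_⟩
    rw [SetLike.mem_coe, Submodule.mem_comap, boundary_boundary_apply]
    exact zero_mem _

lemma chainMap_mem_gradedCycles (f : G ⟶ H) {n : ℕ} {c : RC R G n}
    (hc : c ∈ gradedCycles R G l n) : chainMap R f n c ∈ gradedCycles R H l n := by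
  cases n with
  | zero => exact chainMap_mem_upTo f hc
  | succ n =>
    refine ⟨chainMap_mem_upTo f hc.1, ?_⟩
    rw [SetLike.mem_coe, Submodule.mem_comap, boundary_chainMap_apply]
    exact chainMap_mem_upTo f hc.2

lemma IsEmbedding.mem_gradedCycles {f : G ⟶ H} (hf : IsEmbedding f) {n : ℕ} {c : RC R G n}
    (hc : chainMap R f n c ∈ gradedCycles R H l n) : c ∈ gradedCycles R G l n := by
  cases n with
  | zero => exact hf.mem_chains hc
  | succ n =>
    refine ⟨hf.mem_chains hc.1, hf.mem_chains ?_⟩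
    rw [← boundary_chainMap_apply]
    exact hc.2

lemma mem_filteredReach_iff {p : ℤ} {n : ℕ} {c : RC R G n} :
    c ∈ (filteredReach R G).F p n ↔ c ∈ upTo R G n p :=
  SetLike.ext_iff.mp (lengthFiltration_eq p n) c

lemma filteredReach_d_apply {n : ℕ} (c : RC R G (n + 1)) :
    ((filteredReach R G).C.d (n + 1) n).hom c = boundary R G n c :=
  LinearMap.congr_fun (congrArg ModuleCat.Hom.hom (reachComplex_d R G n)) c

lemma mem_Z_one_iff {n : ℕ} {c : RC R G n} :
    c ∈ (filteredReach R G).Z 1 l n ↔ c ∈ gradedCycles R G l n := by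
  refine (FilteredComplex.mem_Z (filteredReach R G) (x := c)).trans ?_
  cases n with
  | zero =>
    refine ⟨fun h => mem_filteredReach_iff.mp h.1, fun h => ⟨mem_filteredReach_iff.mpr h, fun m => ?_⟩⟩
    rw [(filteredReach R G).C.shape 0 m (by simp)]
    exact zero_mem _
  | succ n =>
    refine and_congr mem_filteredReach_iff ⟨fun h => ?_, fun h m => ?_⟩
    · have := mem_filteredReach_iff.mp (h n)
      exact (congrArg (· ∈ upTo R G n (l - 1)) (filteredReach_d_apply c)).mp this
    · by_cases hm : m = n
      · subst hm
        refine mem_filteredReach_iff.mpr ?_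
        exact (congrArg (· ∈ upTo R G m (l - 1)) (filteredReach_d_apply c)).mpr h
      · rw [(filteredReach R G).C.shape (n + 1) m (fun h' => hm (Nat.succ_injective h'))]
        exact zero_mem _

lemma mem_B_one_iff {n : ℕ} {c : RC R G n} :
    c ∈ (filteredReach R G).B 1 l n ↔ c ∈ gradedBoundaries R G l n := by
  refine (FilteredComplex.mem_B_one (filteredReach R G) (x := c)).trans ⟨?_, fun h => ?_⟩
  · rintro ⟨e, he, w, hw, rfl⟩
    exact Submodule.mem_sup.mpr ⟨e, mem_filteredReach_iff.mp he, _,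
      ⟨w, mem_filteredReach_iff.mp hw, rfl⟩, congrArg (e + ·) (filteredReach_d_apply w).symm⟩
  · obtain ⟨e, he, _, ⟨w, hw, rfl⟩, rfl⟩ := Submodule.mem_sup.mp h
    exact ⟨e, mem_filteredReach_iff.mpr he, w, mem_filteredReach_iff.mpr hw,
      congrArg (e + ·) (filteredReach_d_apply w)⟩

lemma mem_gradedBoundaries {n : ℕ} {c : RC R G n} {b : RC R G (n + 1)}
    (hb : b ∈ upTo R G (n + 1) l) (h : c - boundary R G n b ∈ upTo R G n (l - 1)) :
    c ∈ gradedBoundaries R G l n :=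
  Submodule.mem_sup.mpr ⟨_, h, _, Submodule.mem_map_of_mem hb, sub_add_cancel _ _⟩

lemma exists_of_mem_gradedBoundaries {n : ℕ} {c : RC R G n} (hc : c ∈ gradedBoundaries R G l n) :
    ∃ b ∈ upTo R G (n + 1) l, c - boundary R G n b ∈ upTo R G n (l - 1) := by
  obtain ⟨e, he, _, ⟨b, hb, rfl⟩, rfl⟩ := Submodule.mem_sup.mp hc
  exact ⟨b, hb, by rwa [add_sub_cancel_right]⟩

end graded

/-! ### Splitting graded chains by the last entry -/

section splitting

variable {R : Type v} [CommRing R] {G : DiGraph.{u}} {S : Set G.V} {l : ℤ}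

lemma exists_split {k : ℕ} {c : RC R G k} (hc : c ∈ upTo R G k l) :
    ∃ s ∈ chains R G k (fun x => x (Fin.last k) ∈ S ∧ (G.nlength x : ℤ) ≤ l),
      ∃ t ∈ chains R G k (fun x => x (Fin.last k) ∉ S ∧ (G.nlength x : ℤ) ≤ l), s + t = c :=
  mem_chains_or.mp (chains_mono (fun x _ hx => by tauto) hc)

lemma exists_split_direct {k : ℕ} {c : RC R G k}
    (hc : c ∈ chains R G k (fun x => x (Fin.last k) ∉ S ∧ (G.nlength x : ℤ) ≤ l)) :
    ∃ q ∈ chains R G k (fun x => G.Direct S x ∧ (G.nlength x : ℤ) ≤ l),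
      ∃ d ∈ chains R G k (fun x => G.Detour S x ∧ (G.nlength x : ℤ) ≤ l), q + d = c :=
  mem_chains_or.mp (chains_mono (fun x _ hx => by
    by_cases h : G.Detour S x
    · exact Or.inr ⟨h, hx.2⟩
    · exact Or.inl ⟨⟨hx.1, h⟩, hx.2⟩) hc)

/-- The chains in `S` and the chains outside `S` are independent modulo shorter chains. -/
lemma mem_upTo_of_add_mem {k : ℕ} {s t : RC R G k}
    (hs : s ∈ chains R G k (fun x => x (Fin.last k) ∈ S))
    (ht : t ∈ chains R G k (fun x => x (Fin.last k) ∉ S ∨ (G.nlength x : ℤ) ≤ l))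
    (h : s + t ∈ upTo R G k l) : s ∈ upTo R G k l := by
  have h1 := sub_mem (chains_mono (R := R) (fun x _ hx => Or.inr hx) h) ht
  rw [add_sub_cancel_right] at h1
  exact chains_mono (fun x _ hx => hx.2.resolve_left (not_not_intro hx.1)) (mem_chains_and hs h1)

/-- A face of the same length omits an interior vertex, so the last entry survives. -/
lemma boundary_mem_of_notMem {k : ℕ} {c : RC R G (k + 1)}
    (hc : c ∈ chains R G (k + 1) (fun x => x (Fin.last (k + 1)) ∉ S ∧ (G.nlength x : ℤ) ≤ l)) :
    boundary R G k c ∈ chains R G k (fun x => (x (Fin.last k) ∉ S ∧ (G.nlength x : ℤ) ≤ l) ∨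
      (G.nlength x : ℤ) ≤ l - 1) := by
  refine boundary_mem_chains (fun x hx ⟨hm, hl⟩ i _ => ?_) hc
  rcases nlength_eq_or_le hx hl i with h | h
  · obtain ⟨e, rfl, -⟩ := hx.interior_of_nlength_eq h
    refine Or.inl ⟨?_, by omega⟩
    rwa [Fin.removeNth_apply, Fin.succAbove_of_le_castSucc _ _ (Fin.castSucc_le_castSucc_iff.mpr
      (Fin.le_last _)), Fin.succ_last]
  · exact Or.inr h

variable (hS : G.IsProjective S)

include hS

lemma IsProjective.boundary_mem_of_mem {k : ℕ} {c : RC R G (k + 1)}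
    (hc : c ∈ chains R G (k + 1) (fun x => x (Fin.last (k + 1)) ∈ S)) :
    boundary R G k c ∈ chains R G k (fun x => x (Fin.last k) ∈ S) :=
  boundary_mem_chains (fun _ hx hm _ _ => hS.mem_of_le hx.isReach (Fin.le_last _) hm) hc

lemma IsProjective.boundary_mem_of_detour {k : ℕ} {c : RC R G (k + 1)}
    (hc : c ∈ chains R G (k + 1) (fun x => G.Detour S x ∧ (G.nlength x : ℤ) ≤ l)) :
    boundary R G k c ∈ chains R G k (fun x => (G.Detour S x ∧ (G.nlength x : ℤ) ≤ l) ∨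
      (G.nlength x : ℤ) ≤ l - 1) := by
  refine boundary_mem_chains (fun x hx ⟨⟨c, hd⟩, hl⟩ i _ => ?_) hc
  rcases nlength_eq_or_le hx hl i with h | h
  · obtain ⟨e, he, -⟩ := hS.detourAt_removeNth hx hd h
    exact Or.inl ⟨⟨e, he⟩, by omega⟩
  · exact Or.inr h

/-- The part in `S` of a first page cycle is a first page cycle. -/
lemma IsProjective.split_mem_gradedCycles {n : ℕ} {s t : RC R G n}
    (hs : s ∈ chains R G n (fun x => x (Fin.last n) ∈ S ∧ (G.nlength x : ℤ) ≤ l))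
    (ht : t ∈ chains R G n (fun x => x (Fin.last n) ∉ S ∧ (G.nlength x : ℤ) ≤ l))
    (h : s + t ∈ gradedCycles R G l n) : s ∈ gradedCycles R G l n := by
  have hs' : s ∈ upTo R G n l := chains_mono (fun x _ hx => hx.2) hs
  cases n with
  | zero => exact hs'
  | succ n =>
    have h1 : boundary R G n (s + t) ∈ upTo R G n (l - 1) := h.2
    rw [map_add] at h1
    exact ⟨hs', mem_upTo_of_add_mem
      (hS.boundary_mem_of_mem (chains_mono (fun x _ hx => hx.1) hs))
      (chains_mono (fun x _ hx => hx.imp_left And.left) (boundary_mem_of_notMem ht)) h1⟩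

/-- Acyclicity in the form needed for the first page: shorter tuples are ignored, and degree zero is
included because a single vertex is never a detour. -/
lemma IsProjective.exists_boundary_of_gradedCycles {n : ℕ} {c : RC R G n}
    (hc : c ∈ chains R G n (fun x => (G.Detour S x ∧ (G.nlength x : ℤ) ≤ l) ∨
      (G.nlength x : ℤ) ≤ l - 1))
    (h : c ∈ gradedCycles R G l n) :
    ∃ b ∈ chains R G (n + 1) (fun x => G.Detour S x ∧ (G.nlength x : ℤ) ≤ l),
      c - boundary R G n b ∈ upTo R G n (l - 1) := by
  obtain ⟨d, hd, e, he, rfl⟩ := mem_chains_or.mp hc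
  cases n with
  | zero =>
    refine ⟨0, zero_mem _, ?_⟩
    obtain rfl : d = 0 := chains_eq_zero hd fun x _ ⟨⟨c, _⟩, _⟩ => c.elim0
    rwa [map_zero, sub_zero, zero_add]
  | succ n =>
    have h1 := sub_mem h (upTo_le_gradedCycles he)
    rw [add_sub_cancel_right] at h1
    obtain ⟨b, hb, hdb⟩ := hS.exists_boundary_of_detour hd h1.2
    refine ⟨b, hb, ?_⟩
    rw [add_sub_right_comm]
    exact add_mem hdb he

end splitting

/-! ### Excision and the short exact sequence of first pages -/

section excision

variable {R : Type v} [CommRing R] {A X Y P : DiGraph.{u}} {i : A ⟶ X} {f : A ⟶ Y} {g : X ⟶ P}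
  {j : Y ⟶ P} {l : ℤ}

/-- A first page cycle outside `T` lifts along `g` up to detours. -/
lemma IsExcision.exists_lift {S : Set X.V} {T : Set P.V} (hg : IsExcision g S T)
    (hS : X.IsProjective S) (hT : P.IsProjective T) {n : ℕ} {t : RC R X n} {d : RC R P n}
    (ht : t ∈ chains R X n (fun x => X.Direct S x ∧ (X.nlength x : ℤ) ≤ l))
    (hd : d ∈ chains R P n (fun x => P.Detour T x ∧ (P.nlength x : ℤ) ≤ l))
    (h : chainMap R g n t + d ∈ gradedCycles R P l n) :
    ∃ b ∈ chains R X n (fun x => X.Detour S x ∧ (X.nlength x : ℤ) ≤ l),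
      t - b ∈ gradedCycles R X l n := by
  have htl : t ∈ upTo R X n l := chains_mono (fun x _ hx => hx.2) ht
  cases n with
  | zero =>
    refine ⟨0, zero_mem _, ?_⟩
    rwa [sub_zero]
  | succ n =>
    have h1 : boundary R P n (chainMap R g (n + 1) t + d) ∈ upTo R P n (l - 1) := h.2
    rw [map_add, boundary_chainMap_apply] at h1
    have h2 := sub_mem (chains_mono (fun x _ hx => Or.inr hx) h1)
      (chains_mono (R := R) (fun x _ hx => hx.imp_left And.left) (hT.boundary_mem_of_detour hd))
    rw [add_sub_cancel_right] at h2
    -- `∂ t` consists of detours and shorter tuples because its image does. Being a first page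
    -- cycle, it is `∂ b` up to shorter tuples for a chain `b` of detours.
    have h3 := hg.mem_chains hS
      (boundary_mem_of_notMem (chains_mono (fun x _ hx => ⟨hx.1.1, hx.2⟩) ht)) h2
    obtain ⟨b, hb, h4⟩ := hS.exists_boundary_of_gradedCycles h3 (boundary_mem_gradedCycles htl)
    refine ⟨b, hb, sub_mem htl (chains_mono (fun x _ hx => hx.2) hb), ?_⟩
    rwa [SetLike.mem_coe, Submodule.mem_comap, map_sub]

/-- A commutative square of directed graphs satisfying excision. -/
structure IsExcisive (i : A ⟶ X) (f : A ⟶ Y) (g : X ⟶ P) (j : Y ⟶ P) : Prop where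
  comm : ∀ a, g.toFun (i.toFun a) = j.toFun (f.toFun a)
  left : IsEmbedding i
  right : IsEmbedding j
  projective_left : X.IsProjective (Set.range i.toFun)
  projective_right : P.IsProjective (Set.range j.toFun)
  excision : IsExcision g (Set.range i.toFun) (Set.range j.toFun)

namespace IsExcisive

lemma chainMap_range (i : A ⟶ X) {n : ℕ} (c : RC R A n) :
    chainMap R i n c ∈ chains R X n (fun x => x (Fin.last n) ∈ Set.range i.toFun) :=
  chainMap_mem_chains i (s := fun _ => True) (fun _ _ _ _ => ⟨_, rfl⟩) (fun _ _ => trivial)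

variable (h : IsExcisive i f g j)

include h

lemma chainMap_comm {n : ℕ} (c : RC R A n) :
    chainMap R g n (chainMap R i n c) = chainMap R j n (chainMap R f n c) := by
  induction c using Finsupp.induction_linear with
  | zero => simp only [map_zero]
  | add c d hc hd => simp only [map_add, hc, hd]
  | single x r =>
    rw [show Finsupp.single x r = r • Finsupp.single x 1 by simp]
    simp only [map_smul, chainMap_single]
    rw [chainMap_genOrZero R g (x.2.isReach.map i), chainMap_genOrZero R j (x.2.isReach.map f)]
    congr 2
    exact funext fun a => h.comm (x.1 a)

/-- The complement of `A` is a direct summand modulo shorter chains, so the part in `A` of a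
bounding chain already bounds `a`. -/
lemma mem_gradedBoundaries_left {n : ℕ} {a : RC R A n}
    (hia : chainMap R i n a ∈ gradedBoundaries R X l n) : a ∈ gradedBoundaries R A l n := by
  obtain ⟨w, hw, h1⟩ := exists_of_mem_gradedBoundaries hia
  obtain ⟨s, hs, t, ht, rfl⟩ := exists_split (S := Set.range i.toFun) hw
  obtain ⟨b, hb, rfl⟩ := h.left.exists_chain h.projective_left hs
  refine mem_gradedBoundaries hb (h.left.mem_chains ?_)
  refine mem_upTo_of_add_mem (chainMap_range i _) (t := -boundary R X n t)
    (neg_mem (chains_mono (fun x _ hx => hx.imp_left And.left) (boundary_mem_of_notMem ht))) ?_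
  rw [map_add, boundary_chainMap_apply] at h1
  rw [map_sub]
  convert h1 using 1
  abel

/-- The part of `z` in `Y` lifts as it stands. The direct tuples of the rest lift to `X`, where a
chain of detours corrects the lift to a cycle; the error is a cycle of detours, which bounds. -/
lemma exists_gradedCycles {n : ℕ} {z : RC R P n} (hz : z ∈ gradedCycles R P l n) :
    ∃ x ∈ gradedCycles R X l n, ∃ y ∈ gradedCycles R Y l n,
      z - (chainMap R g n x + chainMap R j n y) ∈ gradedBoundaries R P l n := by
  obtain ⟨s, hs, t, ht, rfl⟩ := exists_split (S := Set.range j.toFun) (gradedCycles_le hz)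
  have hs' := h.projective_right.split_mem_gradedCycles hs ht hz
  have ht' := sub_mem hz hs'
  rw [add_sub_cancel_left] at ht'
  obtain ⟨y, -, rfl⟩ := h.right.exists_chain h.projective_right hs
  obtain ⟨q, hq, d, hd, rfl⟩ := exists_split_direct ht
  obtain ⟨t, htd, rfl⟩ := h.excision.exists_chain hq
  obtain ⟨b, hb, htb⟩ := h.excision.exists_lift h.projective_left h.projective_right htd hd ht'
  refine ⟨t - b, htb, y, h.right.mem_gradedCycles hs', ?_⟩
  have hcyc := sub_mem hz (add_mem (chainMap_mem_gradedCycles g htb) hs')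
  have heq : chainMap R j n y + (chainMap R g n t + d) -
      (chainMap R g n (t - b) + chainMap R j n y) = d + chainMap R g n b := by
    rw [map_sub]
    abel
  rw [heq] at hcyc ⊢
  obtain ⟨c, hc, h1⟩ := h.projective_right.exists_boundary_of_gradedCycles
    (add_mem (chains_mono (fun x _ hx => Or.inl hx) hd)
      (h.excision.chainMap_detour h.projective_left hb)) hcyc
  exact mem_gradedBoundaries (chains_mono (fun x _ hx => hx.2) hc) h1

/-- Take `a` to be the part of `x` in `A`. The part in `Y` of a bounding chain bounds `y + f a`; the
direct tuples outside lift to `X` and bound `x - i a` up to a cycle of detours, which bounds. -/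
lemma exists_gradedCycles_left {n : ℕ} {x : RC R X n} {y : RC R Y n}
    (hx : x ∈ gradedCycles R X l n)
    (hxy : chainMap R g n x + chainMap R j n y ∈ gradedBoundaries R P l n) :
    ∃ a ∈ gradedCycles R A l n, x - chainMap R i n a ∈ gradedBoundaries R X l n ∧
      y + chainMap R f n a ∈ gradedBoundaries R Y l n := by
  obtain ⟨s, hs, t, ht, rfl⟩ := exists_split (S := Set.range i.toFun) (gradedCycles_le hx)
  have hs' := h.projective_left.split_mem_gradedCycles hs ht hx
  have ht' := sub_mem hx hs'
  rw [add_sub_cancel_left] at ht'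
  obtain ⟨a, -, rfl⟩ := h.left.exists_chain h.projective_left hs
  refine ⟨a, h.left.mem_gradedCycles hs', ?_⟩
  rw [add_sub_cancel_left]
  obtain ⟨w, hw, h1⟩ := exists_of_mem_gradedBoundaries hxy
  obtain ⟨_, hsw, _, htw, rfl⟩ := exists_split (S := Set.range j.toFun) hw
  obtain ⟨b, hb, rfl⟩ := h.right.exists_chain h.projective_right hsw
  obtain ⟨q, hq, d, hd, rfl⟩ := exists_split_direct htw
  obtain ⟨t', ht1, rfl⟩ := h.excision.exists_chain hq
  have ht1' : t' ∈ upTo R X (n + 1) l := chains_mono (fun x _ hx => hx.2) ht1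
  have hout : t - boundary R X n t' ∈ chains R X n
      (fun x => (x (Fin.last n) ∉ Set.range i.toFun ∧ (X.nlength x : ℤ) ≤ l) ∨
        (X.nlength x : ℤ) ≤ l - 1) :=
    sub_mem (chains_mono (fun x _ hx => Or.inl hx) ht)
      (boundary_mem_of_notMem (chains_mono (fun x _ hx => ⟨hx.1.1, hx.2⟩) ht1))
  have hd' := h.projective_right.boundary_mem_of_detour hd
  have hgout : chainMap R g n (t - boundary R X n t') ∈ chains R P n
      (fun x => x (Fin.last n) ∉ Set.range j.toFun ∨ (P.nlength x : ℤ) ≤ l - 1) := by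
    refine chainMap_mem_chains g (fun x hx' hx _ => ?_) hout
    refine hx.imp (fun hx hm => hx.1 ((h.excision.mem_iff _).mp hm)) fun hx => ?_
    have := hx'.isReach.nlength_map_le g
    omega
  -- The bounding relation, arranged as a term inside `Y` plus terms ending outside `Y` or shorter;
  -- each of the two sums is then short separately.
  have hsum : chainMap R j n (y + chainMap R f n a - boundary R Y n b) +
      (chainMap R g n (t - boundary R X n t') - boundary R P n d) ∈ upTo R P n (l - 1) := by
    convert h1 using 1
    simp only [map_add, map_sub, h.chainMap_comm, boundary_chainMap_apply]
    abel
  have hj : chainMap R j n (y + chainMap R f n a - boundary R Y n b) ∈ upTo R P n (l - 1) := by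
    refine mem_upTo_of_add_mem (chainMap_range j _) (sub_mem hgout (chains_mono (fun x hx h1 => ?_) hd')) hsum
    exact h1.imp_left fun h2 => h.projective_right.last_notMem hx.isReach h2.1
  refine ⟨?_, mem_gradedBoundaries hb (h.right.mem_chains hj)⟩
  have h2 := sub_mem hsum hj
  rw [add_sub_cancel_left] at h2
  have h3 := add_mem (chains_mono (fun x _ hx => Or.inr hx) h2)
    (chains_mono (R := R) (fun x _ hx => hx.imp_left And.left) hd')
  rw [sub_add_cancel] at h3
  obtain ⟨c, hc, h4⟩ := h.projective_left.exists_boundary_of_gradedCycles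
    (h.excision.mem_chains h.projective_left hout h3)
    (sub_mem ht' (boundary_mem_gradedCycles ht1'))
  refine mem_gradedBoundaries (add_mem ht1' (chains_mono (fun x _ hx => hx.2) hc)) ?_
  rwa [map_add, ← sub_sub]

variable (R) in
lemma isPageOneBicartesian : FilteredComplex.IsPageOneBicartesian (filteredReachMap R i)
    (filteredReachMap R f) (filteredReachMap R g) (filteredReachMap R j) where
  comm _ c := h.chainMap_comm c
  inj _ hia := mem_B_one_iff.mpr (h.mem_gradedBoundaries_left (mem_B_one_iff.mp hia))
  exact hx _ hxy := by
    obtain ⟨a, ha, h1, h2⟩ := h.exists_gradedCycles_left (mem_Z_one_iff.mp hx)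
      (mem_B_one_iff.mp hxy)
    exact ⟨a, mem_Z_one_iff.mpr ha, mem_B_one_iff.mpr h1, mem_B_one_iff.mpr h2⟩
  surj hz := by
    obtain ⟨x, hx, y, hy, h1⟩ := h.exists_gradedCycles (mem_Z_one_iff.mp hz)
    exact ⟨x, mem_Z_one_iff.mpr hx, y, mem_Z_one_iff.mpr hy, mem_B_one_iff.mpr h1⟩

end IsExcisive

end excision

end DiGraph

namespace DiGraph

/-! ### Cofibrations as isometric embeddings with projections -/

section cofibration

variable {A X : DiGraph.{u}}

/-- Every edge into the image of `i` comes from an edge of the source. -/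
def ReflectsEntry (i : A ⟶ X) : Prop :=
  ∀ u a, X.Adj u (i.toFun a) → ∃ b, i.toFun b = u ∧ (b = a ∨ A.Adj b a)

/-- Lift the path backwards from its end; an edge that lifts to an equality only shortens it. -/
lemma ReflectsEntry.hasPath {i : A ⟶ X} (hi : ReflectsEntry i) {n : ℕ} {u v : X.V}
    (p : X.HasPath n u v) (a : A.V) (ha : i.toFun a = v) :
    ∃ b, i.toFun b = u ∧ ∃ m ≤ n, A.HasPath m b a := by
  induction p with
  | nil x => exact ⟨a, ha, 0, le_rfl, .nil a⟩
  | cons h _ ih =>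
    obtain ⟨b, rfl, m, hm, q⟩ := ih ha
    obtain ⟨c, hc, rfl | hcb⟩ := hi _ _ h
    · exact ⟨c, hc, m, by omega, q⟩
    · exact ⟨c, hc, m + 1, by omega, .cons hcb q⟩

lemma ReflectsEntry.mem_range {i : A ⟶ X} (hi : ReflectsEntry i) {x s : X.V}
    (hs : s ∈ Set.range i.toFun) (h : X.Reach x s) : x ∈ Set.range i.toFun := by
  obtain ⟨a, ha⟩ := hs
  obtain ⟨n, p⟩ := h
  obtain ⟨b, hb, -⟩ := hi.hasPath p a ha
  exact ⟨b, hb⟩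

lemma ReflectsEntry.isEmbedding {i : A ⟶ X} (hi : ReflectsEntry i)
    (hinj : Function.Injective i.toFun) : IsEmbedding i where
  injective := hinj
  reach {a b} h := by
    obtain ⟨n, p⟩ := h
    obtain ⟨c, hc, m, -, q⟩ := hi.hasPath p b rfl
    obtain rfl := hinj hc
    exact ⟨m, q⟩
  ndist_eq {a b} h := by
    refine le_antisymm (ndist_map_le i h) ?_
    obtain ⟨c, hc, m, hm, q⟩ := hi.hasPath (h.map i).hasPath_ndist b rfl
    obtain rfl := hinj hc
    exact q.ndist_le.trans hm

namespace IsCofibration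

variable {i : A ⟶ X} (hi : IsCofibration i)

include hi

lemma mem_range_of_adj {x : X.V} {a : A.V} (h : X.Adj x (i.toFun a)) : x ∈ Set.range i.toFun := by
  by_contra hx
  exact hi.no_entry x a hx h

lemma reflectsEntry : ReflectsEntry i := by
  intro u a h
  obtain ⟨b, rfl⟩ := hi.mem_range_of_adj h
  exact ⟨b, rfl, Or.inr ((hi.adj_iff b a).mp h)⟩

lemma isEmbedding : IsEmbedding i := hi.reflectsEntry.isEmbedding hi.injective

lemma isProjective : X.IsProjective (Set.range i.toFun) where
  mem_of_reach hs h := hi.reflectsEntry.mem_range hs h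
  exists_isProj := by
    rintro _ x ⟨a₀, rfl⟩ h₀
    obtain ⟨p, hp⟩ := hi.exists_proj x ⟨a₀, h₀⟩
    -- If `a` reaches `x`, the sum of extended distances is finite, hence so is each term.
    have key : ∀ a, X.Reach (i.toFun a) x →
        X.dist (i.toFun a) (i.toFun p) ≠ ⊤ ∧ X.dist (i.toFun p) x ≠ ⊤ := by
      intro a ha
      have hne : X.dist (i.toFun a) (i.toFun p) + X.dist (i.toFun p) x ≠ ⊤ := by
        rw [← hp a, ha.dist_eq]
        exact ENat.natCast_ne_top _
      exact ⟨ne_top_of_le_ne_top hne le_self_add, ne_top_of_le_ne_top hne le_add_self⟩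
    refine ⟨i.toFun p, ⟨p, rfl⟩, reach_of_dist_ne_top (key a₀ h₀).2, ?_, ?_⟩
    · rintro _ ⟨a, rfl⟩ ha
      exact reach_of_dist_ne_top (key a ha).1
    · rintro _ ⟨a, rfl⟩ ha
      rw [ndist, hp a, ENat.toNat_add (key a ha).1 (key a ha).2]
      rfl

end IsCofibration

end cofibration

/-! ### Paths and projections in the pushout -/

section pushout

variable {A X Y P : DiGraph.{u}}

/-- The pushout of a map along an injective map: the vertices of `Y` together with the vertices of
`X` outside the image of `A`. -/
structure IsGluing (i : A ⟶ X) (f : A ⟶ Y) (g : X ⟶ P) (j : Y ⟶ P) : Prop where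
  comm : ∀ a, g.toFun (i.toFun a) = j.toFun (f.toFun a)
  cover : ∀ v, v ∈ Set.range j.toFun ∨ ∃ x, x ∉ Set.range i.toFun ∧ g.toFun x = v
  injective : Function.Injective j.toFun
  injOn : ∀ {x x'}, x ∉ Set.range i.toFun → x' ∉ Set.range i.toFun → g.toFun x = g.toFun x' →
    x = x'
  notMem : ∀ {x}, x ∉ Set.range i.toFun → g.toFun x ∉ Set.range j.toFun
  adj : ∀ {u v}, P.Adj u v → u = v ∨ (∃ y y', Y.Adj y y' ∧ j.toFun y = u ∧ j.toFun y' = v) ∨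
    ∃ x x', X.Adj x x' ∧ g.toFun x = u ∧ g.toFun x' = v

open Classical in
/-- The map from the vertices of `X` to the vertices of the glued graph. -/
noncomputable def glueFun (i : A ⟶ X) (f : A ⟶ Y) (x : X.V) :
    Y.V ⊕ {x // x ∉ Set.range i.toFun} :=
  if h : x ∈ Set.range i.toFun then Sum.inl (f.toFun h.choose) else Sum.inr ⟨x, h⟩

lemma glueFun_apply {i : A ⟶ X} (f : A ⟶ Y) (hi : Function.Injective i.toFun) (a : A.V) :
    glueFun i f (i.toFun a) = Sum.inl (f.toFun a) := by
  have h : i.toFun a ∈ Set.range i.toFun := ⟨a, rfl⟩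
  rw [glueFun, dif_pos h, hi h.choose_spec]

lemma glueFun_of_notMem {i : A ⟶ X} (f : A ⟶ Y) {x : X.V} (h : x ∉ Set.range i.toFun) :
    glueFun i f x = Sum.inr ⟨x, h⟩ := dif_neg h

/-- The graph obtained by gluing `X` to `Y` along `A`. -/
noncomputable def glue (i : A ⟶ X) (f : A ⟶ Y) : DiGraph.{u} where
  V := Y.V ⊕ {x // x ∉ Set.range i.toFun}
  graph :=
    { Adj := fun u v => (∃ y y', Y.Adj y y' ∧ Sum.inl y = u ∧ Sum.inl y' = v) ∨
        ∃ x x', X.Adj x x' ∧ glueFun i f x = u ∧ glueFun i f x' = v }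

/-- The map from `X` to the glued graph. -/
noncomputable def glueLeft (i : A ⟶ X) (f : A ⟶ Y) : X ⟶ glue i f :=
  ⟨glueFun i f, fun x x' h => Or.inr (Or.inr ⟨x, x', h, rfl, rfl⟩)⟩

/-- The map from `Y` to the glued graph. -/
noncomputable def glueRight (i : A ⟶ X) (f : A ⟶ Y) : Y ⟶ glue i f :=
  ⟨Sum.inl, fun y y' h => Or.inr (Or.inl ⟨y, y', h, rfl, rfl⟩)⟩

/-- Only the universal property of `P` is used. The induced map `d` to the concrete gluing has the
left inverse `e`, so vertices and edges of `P` can be read off from their images; an edge that `d`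
collapses is a loop of `P`. -/
lemma isGluing_of_isPushout {i : A ⟶ X} {f : A ⟶ Y} {g : X ⟶ P} {j : Y ⟶ P}
    (hi : Function.Injective i.toFun) (h : IsPushout i f g j) : IsGluing i f g j := by
  have hcomm : ∀ a, g.toFun (i.toFun a) = j.toFun (f.toFun a) := fun a =>
    congrArg (fun φ : A ⟶ P => φ.toFun a) h.w
  have hw : i ≫ glueLeft i f = f ≫ glueRight i f :=
    Hom.ext (funext fun a => glueFun_apply f hi a)
  let d : P ⟶ glue i f := h.desc (glueLeft i f) (glueRight i f) hw
  have hdg : ∀ x, d.toFun (g.toFun x) = glueFun i f x := fun x =>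
    congrArg (fun φ : X ⟶ glue i f => φ.toFun x) (h.inl_desc _ _ hw)
  have hdj : ∀ y, d.toFun (j.toFun y) = Sum.inl y := fun y =>
    congrArg (fun φ : Y ⟶ glue i f => φ.toFun y) (h.inr_desc _ _ hw)
  let e₀ : (glue i f).V → P.V := Sum.elim j.toFun fun x => g.toFun x.1
  have he₀ : ∀ x, e₀ (glueFun i f x) = g.toFun x := by
    intro x
    by_cases hx : x ∈ Set.range i.toFun
    · obtain ⟨a, rfl⟩ := hx
      rw [glueFun_apply f hi]
      exact (hcomm a).symm
    · rw [glueFun_of_notMem f hx]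
      rfl
  let e : glue i f ⟶ P := ⟨e₀, by
    rintro _ _ (⟨y, y', hy, rfl, rfl⟩ | ⟨x, x', hx, rfl, rfl⟩)
    · exact j.map_adj y y' hy
    · rw [he₀, he₀]
      exact g.map_adj x x' hx⟩
  have hde : d ≫ e = 𝟙 P := by
    refine h.hom_ext (Hom.ext (funext fun x => ?_)) (Hom.ext (funext fun y => ?_))
    · exact (congrArg e₀ (hdg x)).trans (he₀ x)
    · exact congrArg e₀ (hdj y)
  have hed : ∀ v, e₀ (d.toFun v) = v := fun v => congrArg (fun φ : P ⟶ P => φ.toFun v) hde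
  refine ⟨hcomm, fun v => ?_, fun y y' hy => ?_, fun {x x'} hx hx' hxx => ?_, fun {x} hx => ?_,
    fun {u v} huv => ?_⟩
  · rcases hv : d.toFun v with y | x
    · exact Or.inl ⟨y, by rw [← hed v, hv]; rfl⟩
    · exact Or.inr ⟨x.1, x.2, by rw [← hed v, hv]; rfl⟩
  · have := congrArg d.toFun hy
    rw [hdj, hdj] at this
    exact Sum.inl_injective this
  · have := congrArg d.toFun hxx
    rw [hdg, hdg, glueFun_of_notMem f hx, glueFun_of_notMem f hx'] at this
    exact congrArg Subtype.val (Sum.inr_injective this)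
  · rintro ⟨y, hy⟩
    have := congrArg d.toFun hy
    rw [hdj, hdg, glueFun_of_notMem f hx] at this
    exact Sum.inl_ne_inr this
  · rcases d.map_adj u v huv with h1 | ⟨y, y', hy, h1, h2⟩ | ⟨x, x', hx, h1, h2⟩
    · left
      rw [← hed u, h1, hed]
    · exact Or.inr (Or.inl ⟨y, y', hy, by rw [← hed u, ← h1]; rfl, by rw [← hed v, ← h2]; rfl⟩)
    · exact Or.inr (Or.inr ⟨x, x', hx, by rw [← hed u, ← h1, he₀], by rw [← hed v, ← h2, he₀]⟩)

namespace IsGluing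

variable {i : A ⟶ X} {f : A ⟶ Y} {g : X ⟶ P} {j : Y ⟶ P} (h : IsGluing i f g j)

include h

lemma mem_iff (x : X.V) : g.toFun x ∈ Set.range j.toFun ↔ x ∈ Set.range i.toFun := by
  refine ⟨fun hx => by_contra fun hn => h.notMem hn hx, ?_⟩
  rintro ⟨a, rfl⟩
  exact ⟨_, (h.comm a).symm⟩

variable (hi : IsCofibration i)

include hi

lemma reflectsEntry : ReflectsEntry j := by
  intro u y hu
  rcases h.adj hu with rfl | ⟨y₀, y₁, hy, rfl, hy'⟩ | ⟨x₀, x₁, hx, rfl, hx'⟩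
  · exact ⟨y, rfl, Or.inl rfl⟩
  · exact ⟨y₀, rfl, Or.inr (h.injective hy' ▸ hy)⟩
  -- An edge of `X` ending in `A` is an edge of `A`, which `f` may collapse; this is the case of
  -- equality in `ReflectsEntry`.
  · obtain ⟨a₁, rfl⟩ := (h.mem_iff x₁).mp ⟨y, hx'.symm⟩
    obtain ⟨a₀, rfl⟩ := hi.mem_range_of_adj hx
    rw [h.comm] at hx'
    obtain rfl := h.injective hx'
    exact ⟨_, (h.comm a₀).symm, f.map_adj a₀ a₁ ((hi.adj_iff _ _).mp hx)⟩

/-- A path in the pushout to a vertex outside `Y` stays outside `Y`, or consists of a path in `Y`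
and a path in `X` starting in `A`. -/
lemma hasPath {n : ℕ} {u v : P.V} (p : P.HasPath n u v) {x : X.V} (hx : x ∉ Set.range i.toFun)
    (hv : g.toFun x = v) :
    (∃ x₀, x₀ ∉ Set.range i.toFun ∧ g.toFun x₀ = u ∧ ∃ m ≤ n, X.HasPath m x₀ x) ∨
      ∃ y a m m', j.toFun y = u ∧ m + m' ≤ n ∧ Y.HasPath m y (f.toFun a) ∧
        X.HasPath m' (i.toFun a) x := by
  induction p with
  | nil _ => exact Or.inl ⟨x, hx, hv, 0, le_rfl, .nil x⟩
  | cons huv _ ih =>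
    rcases ih hv with ⟨x₁, hx₁, rfl, m, hm, q⟩ | ⟨y, a, m, m', rfl, hm, q, q'⟩
    · rcases h.adj huv with rfl | ⟨y₀, y₁, -, -, hy⟩ | ⟨x₀, x₁', hadj, rfl, hx'⟩
      · exact Or.inl ⟨x₁, hx₁, rfl, m, by omega, q⟩
      · exact absurd ⟨y₁, hy⟩ (h.notMem hx₁)
      · have hx₁' : x₁' ∉ Set.range i.toFun := fun hm =>
          h.notMem hx₁ (hx' ▸ (h.mem_iff _).mpr hm)
        obtain rfl := h.injOn hx₁' hx₁ hx'
        by_cases hx₀ : x₀ ∈ Set.range i.toFun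
        · obtain ⟨a, rfl⟩ := hx₀
          exact Or.inr ⟨f.toFun a, a, 0, m + 1, (h.comm a).symm, by omega, .nil _, .cons hadj q⟩
        · exact Or.inl ⟨x₀, hx₀, rfl, m + 1, by omega, .cons hadj q⟩
    · obtain ⟨y₀, hy₀, rfl | hadj⟩ := h.reflectsEntry hi _ _ huv
      · exact Or.inr ⟨y₀, a, m, m', hy₀, by omega, q, q'⟩
      · exact Or.inr ⟨y₀, a, m + 1, m', hy₀, by omega, .cons hadj q, q'⟩

lemma hasPath_of_notMem {n : ℕ} {x x' : X.V} (hx : x ∉ Set.range i.toFun)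
    (hx' : x' ∉ Set.range i.toFun) (p : P.HasPath n (g.toFun x) (g.toFun x')) :
    ∃ m ≤ n, X.HasPath m x x' := by
  rcases h.hasPath hi p hx' rfl with ⟨x₀, hx₀, he, q⟩ | ⟨y, -, -, -, hy, -⟩
  · rwa [h.injOn hx₀ hx he] at q
  · exact absurd ⟨y, hy⟩ (h.notMem hx)

lemma hasPath_of_right {n : ℕ} {y : Y.V} {x : X.V} (hx : x ∉ Set.range i.toFun)
    (p : P.HasPath n (j.toFun y) (g.toFun x)) :
    ∃ a m m', m + m' ≤ n ∧ Y.HasPath m y (f.toFun a) ∧ X.HasPath m' (i.toFun a) x := by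
  rcases h.hasPath hi p hx rfl with ⟨x₀, hx₀, he, -⟩ | ⟨y', a, m, m', hy, hm, q, q'⟩
  · exact absurd ⟨y, he.symm⟩ (h.notMem hx₀)
  · obtain rfl := h.injective hy
    exact ⟨a, m, m', hm, q, q'⟩

/-- A shortest path from `y` to `x` passes through some `f a` and then runs in `X`, so it is at
least as long as `d(y, f a) + d(a, p) + d(p, x)`. Neither `f` nor `j` increases distances, so this
bounds `d(y, p) + d(p, x)` in `P` from above. -/
lemma isProj {p x : X.V} (hx : x ∉ Set.range i.toFun) (hp : X.IsProj (Set.range i.toFun) p x) :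
    P.IsProj (Set.range j.toFun) (g.toFun p) (g.toFun x) := by
  obtain ⟨a₀, rfl⟩ := hp.mem
  have hreach : ∀ {a y m m'}, Y.HasPath m y (f.toFun a) → X.HasPath m' (i.toFun a) x →
      A.Reach a a₀ ∧ P.Reach (j.toFun y) (j.toFun (f.toFun a₀)) := fun {a y m m'} q q' => by
    have h1 := hi.isEmbedding.reach (hp.reach_of_reach _ ⟨a, rfl⟩ ⟨m', q'⟩)
    exact ⟨h1, (Reach.map j ⟨m, q⟩).trans ((h1.map f).map j)⟩
  refine ⟨(h.mem_iff _).mpr hp.mem, hp.reach.map g, ?_, ?_⟩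
  · rintro _ ⟨y, rfl⟩ ⟨n, r⟩
    obtain ⟨a, m, m', -, q, q'⟩ := h.hasPath_of_right hi hx r
    rw [h.comm]
    exact (hreach q q').2
  · rintro _ ⟨y, rfl⟩ hr
    obtain ⟨a, m, m', hm, q, q'⟩ := h.hasPath_of_right hi hx hr.hasPath_ndist
    obtain ⟨h1, h2⟩ := hreach q q'
    refine le_antisymm (ndist_triangle (by rw [h.comm]; exact h2) (hp.reach.map g)) ?_
    have h3 := ndist_map_le g hp.reach
    have h4 := hp.ndist_eq _ ⟨a, rfl⟩ ⟨m', q'⟩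
    rw [hi.isEmbedding.ndist_eq h1] at h4
    have h5 := ndist_triangle (Reach.map j ⟨m, q⟩) ((h1.map f).map j)
    have h6 := ndist_map_le j (x := y) (y := f.toFun a) ⟨m, q⟩
    have h7 := (ndist_map_le j (h1.map f)).trans (ndist_map_le f h1)
    have h8 := q.ndist_le
    have h9 := q'.ndist_le
    rw [h.comm] at h3 ⊢
    omega

/-- A shortest path of `P` from `p` to `x` ends with a path of `X` from some `a`, whose length is at
least `d(a, x) = d(a, p) + d(p, x)`. -/
lemma ndist_proj {p x : X.V} (hx : x ∉ Set.range i.toFun)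
    (hp : X.IsProj (Set.range i.toFun) p x) :
    P.ndist (g.toFun p) (g.toFun x) = X.ndist p x := by
  refine le_antisymm (ndist_map_le g hp.reach) ?_
  obtain ⟨a₀, ha₀⟩ := hp.mem
  have hr := (hp.reach.map g).hasPath_ndist
  conv at hr => arg 3; rw [← ha₀, h.comm]
  obtain ⟨a, m, m', hm, -, q'⟩ := h.hasPath_of_right hi hx hr
  have h1 := hp.ndist_eq _ ⟨a, rfl⟩ ⟨m', q'⟩
  have h2 := q'.ndist_le
  omega

lemma exists_isProj {s : P.V} {x : X.V} (hx : x ∉ Set.range i.toFun)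
    (hs : s ∈ Set.range j.toFun) (hr : P.Reach s (g.toFun x)) :
    ∃ p, X.IsProj (Set.range i.toFun) p x := by
  obtain ⟨y, rfl⟩ := hs
  obtain ⟨n, r⟩ := hr
  obtain ⟨a, m, m', -, -, q'⟩ := h.hasPath_of_right hi hx r
  exact hi.isProjective.exists_isProj ⟨a, rfl⟩ ⟨m', q'⟩

lemma isExcisive : IsExcisive i f g j where
  comm := h.comm
  left := hi.isEmbedding
  right := (h.reflectsEntry hi).isEmbedding h.injective
  projective_left := hi.isProjective
  projective_right :=
    { mem_of_reach := fun hs hr => (h.reflectsEntry hi).mem_range hs hr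
      exists_isProj := fun {s v} hs hr => by
        rcases h.cover v with hv | ⟨x, hx, rfl⟩
        · exact ⟨v, isProj_self hv⟩
        · obtain ⟨p, hp⟩ := h.exists_isProj hi hx hs hr
          exact ⟨_, h.isProj hi hx hp⟩ }
  excision :=
    { mem_iff := h.mem_iff
      injOn := h.injOn
      surjOn := fun v hv => (h.cover v).resolve_left hv
      reach := fun hx hx' hr => by
        obtain ⟨m, -, q⟩ := h.hasPath_of_notMem hi hx hx' hr.hasPath_ndist
        exact ⟨m, q⟩
      ndist_eq := fun hx hx' hr => by
        obtain ⟨m, hm, q⟩ := h.hasPath_of_notMem hi hx hx' (hr.map g).hasPath_ndist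
        exact le_antisymm (ndist_map_le g hr) (q.ndist_le.trans hm)
      isProj := h.isProj hi
      ndist_proj := h.ndist_proj hi
      exists_isProj := h.exists_isProj hi }

end IsGluing

end pushout

end DiGraph

/-- The Mayer–Vietoris long exact sequence in bigraded path homology for a pushout square
`A → X`, `A → Y`, `X → P`, `Y → P` of directed graphs in which `A → X` is a cofibration. -/
theorem mainTheorem8 (R : Type v) [CommRing R] {A X Y P : DiGraph.{u}}
    (i : A ⟶ X) (f : A ⟶ Y) (g : X ⟶ P) (j : Y ⟶ P)
    (hi : DiGraph.IsCofibration i) (h : IsPushout i f g j) :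
    ∃ δ : ∀ (k : ℕ) (l : ℤ), DiGraph.PH R P (k + 1) (l + 1) →ₗ[R] DiGraph.PH R A k l,
      (∀ (k : ℕ) (l : ℤ), Function.Exact
        ((DiGraph.PH.map R i k l).prod (-DiGraph.PH.map R f k l))
        ((DiGraph.PH.map R g k l).coprod (DiGraph.PH.map R j k l))) ∧
      (∀ (k : ℕ) (l : ℤ), Function.Exact
        ((DiGraph.PH.map R g (k + 1) (l + 1)).coprod (DiGraph.PH.map R j (k + 1) (l + 1)))
        (δ k l)) ∧
      (∀ (k : ℕ) (l : ℤ), Function.Exact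
        (δ k l)
        ((DiGraph.PH.map R i k l).prod (-DiGraph.PH.map R f k l))) ∧
      (∀ l : ℤ, Function.Surjective
        ((DiGraph.PH.map R g 0 l).coprod (DiGraph.PH.map R j 0 l))) := by
  have S := ((DiGraph.isGluing_of_isPushout hi.injective h).isExcisive hi).isPageOneBicartesian R
  choose δ hδ using S.exists_connecting
  exact ⟨fun k l => δ l k, fun k l => S.exact_middle l k, fun k l =>
    FilteredComplex.IsPageOneBicartesian.exact_right (hδ l k),
    fun k l => S.exact_left (hδ l k), S.surjective_zero⟩
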